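/- Fix an integer $n\ge 2$. A Gelfand--Tsetlin tableau of height $n$ is an array $T(R)$ of complex numbers $R=(r_{ki})_{1\le i\le k\le n}$. Let $T(L)$ be a generic tableau of height $n$, i.e. $l_{ki}-l_{kj}\notin\mathbb Z$ for all $1\le i\ne j\le k\le n-1$. Let $\mathcal B(T(L))$ be the set of all tableaux $T(R)$ with $r_{nj}=l_{nj}$ for $1\le j\le n$ and $r_{ki}-l_{ki}\in\mathbb Z$ for $1\le i\le k\le n-1$, and let $V(T(L))$ be the complex vector space with basis $\mathcal B(T(L))$, considered as a $\mathfrak{gl}(n)$-module by the Gelfand--Tsetlin formulas $$E_{k,k+1}T(R)=-\sum_{i=1}^{k}\frac{\prod_{j=1}^{k+1}(r_{ki}-r_{k+1,j})}{\prod_{j\ne i}(r_{ki}-r_{kj})}\,T(R+\delta^{ki}),\qquad E_{k+1,k}T(R)=\sum_{i=1}^{k}\frac{\prod_{j=1}^{k-1}(r_{ki}-r_{k-1,j})}{\prod_{j\ne i}(r_{ki}-r_{kj})}\,T(R-\delta^{ki})\qquad(1\le k\le n-1),$$ $$E_{kk}T(R)=\Big(k-1+\sum_{i=1}^{k}r_{ki}-\sum_{i=1}^{k-1}r_{k-1,i}\Big)T(R)\qquad(1\le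 k\le n),$$ where $j$ runs over $1,\dots,k$ in the products over $j\ne i$, and $\delta^{ki}$ is the array with a $1$ at position $(k,i)$ and $0$ elsewhere. For $T(R)\in\mathcal B(T(L))$ let $U\cdot T(R)$ be the submodule of $V(T(L))$ generated by $T(R)$, and put $$\Omega^+(T(R))=\{(p,s,u): 1<p\le n,\ 1\le s\le p,\ 1\le u\le p-1,\ r_{p,s}-r_{p-1,u}\in\mathbb Z_{\ge 0}\}.$$ Let $N$ be any $\mathfrak{gl}(n)$-submodule of $V(T(L))$. Then $N$ is finitely generated. More precisely, let $\Phi$ be the set of all tableaux $T(R)\in\mathcal B(T(L))\cap N$ such that every $T(P)\in\mathcal B(T(L))\cap N$ with $\Omega^+(T(P))\subseteq\Omega^+(T(R))$ satisfies $\Omega^+(T(P))=\Omega^+(T(R))$, and let $T(Q)\sim T(R)$ mean $\Omega^+(T(Q))=\Omega^+(T(R))$. Then $\Phi$ has a set of distinct representatives modulo $\sim$, and every such set $\tilde\Phi$ is finite and satisfies $$N=\sum_{T(R)\in\tilde\Phi}U\cdot T(R).$$ -/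

import Mathlib

attribute [local instance 100] LieRing.ofAssociativeRing

namespace GT
open Finset

/-! ## Tableaux and the Gelfand--Tsetlin operators -/

/-- The complex vector space of formal finite linear combinations of elements of `B`. -/
def FormalSpan (B : Type*) : Type _ := B →₀ ℂ

noncomputable instance (B : Type*) : AddCommGroup (FormalSpan B) :=
  inferInstanceAs (AddCommGroup (B →₀ ℂ))

noncomputable instance (B : Type*) : Module ℂ (FormalSpan B) :=
  inferInstanceAs (Module ℂ (B →₀ ℂ))

namespace FormalSpan
variable {B : Type*}

/-- The vector `c R`, for a basis element `R` and a scalar `c`. -/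
noncomputable def vec (R : B) (c : ℂ) : FormalSpan B := Finsupp.single R c

theorem vec_add (R : B) (c d : ℂ) : vec R (c + d) = vec R c + vec R d := Finsupp.single_add R c d
theorem vec_sub (R : B) (c d : ℂ) : vec R (c - d) = vec R c - vec R d := Finsupp.single_sub R c d
theorem vec_neg (R : B) (c : ℂ) : vec R (-c) = -vec R c := Finsupp.single_neg R c
theorem vec_zero (R : B) : vec R 0 = 0 := Finsupp.single_zero R
theorem smul_vec (R : B) (c d : ℂ) : c • vec R d = vec R (c * d) := Finsupp.smul_single c R d
theorem vec_sum {ι : Type*} (R : B) (s : Finset ι) (c : ι → ℂ) :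
    vec R (∑ i ∈ s, c i) = ∑ i ∈ s, vec R (c i) := Finsupp.single_finsetSum s c R

theorem hom_ext {V : Type*} [AddCommGroup V] [Module ℂ V] {f g : FormalSpan B →ₗ[ℂ] V}
    (h : ∀ R, f (vec R 1) = g (vec R 1)) : f = g :=
  Finsupp.lhom_ext' (M := ℂ) (α := B) fun R => LinearMap.ext_ring (h R)

/-- The linear map with prescribed values on the basis. -/
noncomputable def lift {V : Type*} [AddCommGroup V] [Module ℂ V] (f : B → V) :
    FormalSpan B →ₗ[ℂ] V :=
  Finsupp.linearCombination ℂ f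

theorem lift_vec {V : Type*} [AddCommGroup V] [Module ℂ V] (f : B → V) (R : B) (c : ℂ) :
    lift f (vec R c) = c • f R :=
  Finsupp.linearCombination_single ℂ c R

end FormalSpan

open FormalSpan

/-- The linear operator sending each basis element `R` to `p(R) s(R)`. -/
noncomputable def wShift {B : Type*} (s : B → B) (p : B → ℂ) : Module.End ℂ (FormalSpan B) :=
  lift fun R => vec (s R) (p R)

theorem wShift_vec {B : Type*} (s : B → B) (p : B → ℂ) (R : B) (c : ℂ) :
    wShift s p (vec R c) = vec (s R) (p R * c) := by
  rw [wShift, lift_vec, smul_vec, mul_comm]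

/-- The positions `(k, i)`, `1 ≤ i ≤ k ≤ n`, of a triangular array with rows `1, …, n`; row `k` has
`k` entries. -/
abbrev Pos (n : ℕ) : Type := {p : ℕ × ℕ // 1 ≤ p.2 ∧ p.2 ≤ p.1 ∧ p.1 ≤ n}

/-- A Gelfand--Tsetlin tableau of height `n`, i.e. a vector in `ℂ^{n(n+1)/2}`. -/
abbrev Tableau (n : ℕ) : Type := Pos n → ℂ

/-- The entry `r_{ki}` of the tableau `R` (with value `0` outside the triangle). -/
def entry {n : ℕ} (R : Tableau n) (k i : ℕ) : ℂ :=
  if h : 1 ≤ i ∧ i ≤ k ∧ k ≤ n then R ⟨(k, i), h⟩ else 0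

/-- A tableau is generic if in each of the rows `1, …, n - 1` no two entries differ by an integer. -/
def IsGeneric {n : ℕ} (L : Tableau n) : Prop :=
  ∀ k i j, k < n → i ∈ Icc 1 k → j ∈ Icc 1 k → i ≠ j → ∀ m : ℤ, entry L k i - entry L k j ≠ m

/-- The set `𝓑(T(L))` of all tableaux `L + z`, with `z` an integral array whose top row is zero. -/
def tableaux {n : ℕ} (L : Tableau n) : Set (Tableau n) :=
  {R | ∃ z : Pos n → ℤ, (∀ p, p.1.1 = n → z p = 0) ∧ ∀ p, R p = L p + z p}

/-- The tableau `R + e δ^{ki}` (for rows `k < n`; the top row is never changed). -/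
def shift {n : ℕ} {L : Tableau n} (R : tableaux L) (k i : ℕ) (e : ℤ) : tableaux L :=
  ⟨fun p => R.1 p + if p.1 = (k, i) ∧ k < n then (e : ℂ) else 0, by
    obtain ⟨z, hz, hR⟩ := R.2
    refine ⟨fun p => z p + if p.1 = (k, i) ∧ k < n then e else 0, ?_, ?_⟩
    · intro p hp
      have : ¬ (p.1 = (k, i) ∧ k < n) := by
        rintro ⟨h1, h2⟩; rw [h1] at hp; simp at hp; omega
      simp [hz p hp, this]
    · intro p
      simp only [hR p]; split_ifs <;> simp [add_assoc]⟩

section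
variable {n : ℕ} {L : Tableau n}

/-- The coefficient of `R + δ^{ki}` in `E_{k,k+1} R`. -/
noncomputable def upCoeff (R : Tableau n) (k i : ℕ) : ℂ :=
  -((∏ j ∈ Icc 1 (k + 1), (entry R k i - entry R (k + 1) j)) /
    ∏ j ∈ (Icc 1 k).erase i, (entry R k i - entry R k j))

/-- The coefficient of `R - δ^{ki}` in `E_{k+1,k} R`. -/
noncomputable def downCoeff (R : Tableau n) (k i : ℕ) : ℂ :=
  (∏ j ∈ Icc 1 (k - 1), (entry R k i - entry R (k - 1) j)) /
    ∏ j ∈ (Icc 1 k).erase i, (entry R k i - entry R k j)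

/-- The eigenvalue of `E_{kk}` on `R`. -/
def weight (R : Tableau n) (k : ℕ) : ℂ :=
  (k : ℂ) - 1 + ∑ i ∈ Icc 1 k, entry R k i - ∑ i ∈ Icc 1 (k - 1), entry R (k - 1) i

/-- The action of `E_{k,k+1}`, `1 ≤ k < n`, by the Gelfand--Tsetlin formulas. -/
noncomputable def opE (L : Tableau n) (k : ℕ) : Module.End ℂ (FormalSpan (tableaux L)) :=
  ∑ i ∈ Icc 1 k, wShift (fun R => shift R k i 1) fun R => upCoeff R.1 k i

/-- The action of `E_{k+1,k}`, `1 ≤ k < n`, by the Gelfand--Tsetlin formulas. -/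
noncomputable def opF (L : Tableau n) (k : ℕ) : Module.End ℂ (FormalSpan (tableaux L)) :=
  ∑ i ∈ Icc 1 k, wShift (fun R => shift R k i (-1)) fun R => downCoeff R.1 k i

/-- The action of `E_{kk}`, `1 ≤ k ≤ n`, by the Gelfand--Tsetlin formulas. -/
noncomputable def opH (L : Tableau n) (k : ℕ) : Module.End ℂ (FormalSpan (tableaux L)) :=
  wShift id fun R => weight R.1 k

end

/-! ## Lie algebra maps out of `gl(n)` from generators -/

/-- `E_{i,i+1+d}` as an iterated commutator of the `x k = E_{k,k+1}`. -/
def upRoot {A : Type*} [LieRing A] (x : ℕ → A) (i : ℕ) : ℕ → A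
  | 0 => x i
  | d + 1 => ⁅upRoot x i d, x (i + d + 1)⁆

/-- `E_{i+1+d,i}` as an iterated commutator of the `y k = E_{k+1,k}`. -/
def dnRoot {A : Type*} [LieRing A] (y : ℕ → A) (i : ℕ) : ℕ → A
  | 0 => y i
  | d + 1 => ⁅y (i + d + 1), dnRoot y i d⁆

/-- The element `E_{ij}` built from `x k = E_{k,k+1}`, `y k = E_{k+1,k}` and `h k = E_{kk}`. -/
def rootVec {A : Type*} [LieRing A] (x y h : ℕ → A) (i j : ℕ) : A :=
  if i < j then upRoot x i (j - i - 1)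
  else if j < i then dnRoot y j (i - j - 1)
  else h i

/-- The defining relations of `gl(n)` (indices `0, …, n - 1`); proved below for the Gelfand--Tsetlin
operators and used only to show that they define a representation. -/
structure ChevalleyRel {A : Type*} [LieRing A] (n : ℕ) (x y h : ℕ → A) : Prop where
  hh : ∀ i j, i < n → j < n → ⁅h i, h j⁆ = 0
  hx : ∀ i k, i < n → k + 1 < n →
    ⁅h i, x k⁆ = (if i = k then x k else 0) - (if i = k + 1 then x k else 0)
  hy : ∀ i k, i < n → k + 1 < n →
    ⁅h i, y k⁆ = (if i = k + 1 then y k else 0) - (if i = k then y k else 0)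
  xy : ∀ k l, k + 1 < n → l + 1 < n → ⁅x k, y l⁆ = if k = l then h k - h (k + 1) else 0
  xx : ∀ k l, k + 1 < n → l + 1 < n → k + 1 < l → ⁅x k, x l⁆ = 0
  yy : ∀ k l, k + 1 < n → l + 1 < n → k + 1 < l → ⁅y k, y l⁆ = 0
  sx : ∀ k, k + 2 < n → ⁅x k, ⁅x k, x (k + 1)⁆⁆ = 0
  sx' : ∀ k, k + 2 < n → ⁅x (k + 1), ⁅x (k + 1), x k⁆⁆ = 0
  sy : ∀ k, k + 2 < n → ⁅y k, ⁅y k, y (k + 1)⁆⁆ = 0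
  sy' : ∀ k, k + 2 < n → ⁅y (k + 1), ⁅y (k + 1), y k⁆⁆ = 0

section
variable {A : Type*} [LieRing A] {n : ℕ} {x y h : ℕ → A}

theorem dnRoot_eq (y : ℕ → A) (i d : ℕ) : dnRoot y i d = -upRoot (fun k => -y k) i d := by
  induction d with
  | zero => simp [dnRoot, upRoot]
  | succ d ih =>
    rw [dnRoot, upRoot, ih]; simp

theorem upRoot_eq_neg (y : ℕ → A) (i d : ℕ) : upRoot (fun k => -y k) i d = - dnRoot y i d := by
  rw [dnRoot_eq, neg_neg]

/-- The Chevalley involution. -/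
theorem ChevalleyRel.swap (H : ChevalleyRel n x y h) :
    ChevalleyRel n (fun k => -y k) (fun k => -x k) (fun k => -h k) where
  hh i j hi hj := by simp [H.hh i j hi hj]
  hx i k hi hk := by
    simp only [lie_neg, neg_lie, neg_neg, H.hy i k hi hk]; split_ifs <;> simp
  hy i k hi hk := by
    simp only [lie_neg, neg_lie, neg_neg, H.hx i k hi hk]; split_ifs <;> simp
  xy k l hk hl := by
    simp only [lie_neg, neg_lie, neg_neg]
    rw [← lie_skew, H.xy l k hl hk]
    split_ifs with h1 h2 h2
    · subst h1; abel
    · exact absurd h1.symm h2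
    · exact absurd h2.symm h1
    · simp
  xx k l hk hl hkl := by simp [H.yy k l hk hl hkl]
  yy k l hk hl hkl := by simp [H.xx k l hk hl hkl]
  sx k hk := by simp [H.sy k hk]
  sx' k hk := by simp [H.sy' k hk]
  sy k hk := by simp [H.sx k hk]
  sy' k hk := by simp [H.sx' k hk]

theorem rootVec_swap (x y h : ℕ → A) (i j : ℕ) :
    rootVec (fun k => -y k) (fun k => -x k) (fun k => -h k) i j = - rootVec x y h j i := by
  unfold rootVec
  rcases lt_trichotomy i j with hij | rfl | hij
  · simp [hij, hij.not_gt, upRoot_eq_neg]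
  · simp
  · simp [hij, hij.not_gt, dnRoot_eq]

theorem rootVec_succ (x y h : ℕ → A) {i j : ℕ} (hij : i < j) :
    rootVec x y h i (j + 1) = ⁅rootVec x y h i j, x j⁆ := by
  obtain ⟨d, rfl⟩ := Nat.exists_eq_add_of_lt hij
  unfold rootVec
  rw [if_pos (by omega), if_pos (by omega),
    show i + d + 1 + 1 - i - 1 = d + 1 by omega, show i + d + 1 - i - 1 = d by omega, upRoot]

theorem rootVec_self_succ (x y h : ℕ → A) (i : ℕ) : rootVec x y h i (i + 1) = x i := by
  simp [rootVec, upRoot]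

theorem rootVec_succ_self (x y h : ℕ → A) (i : ℕ) : rootVec x y h (i + 1) i = y i := by
  simp [rootVec, dnRoot]

theorem rootVec_self (x y h : ℕ → A) (i : ℕ) : rootVec x y h i i = h i := by
  simp [rootVec]

theorem ChevalleyRel.lie_h_up (H : ChevalleyRel n x y h) {i j l : ℕ} (hl : l < n) (hij : i < j)
    (hj : j < n) : ⁅h l, rootVec x y h i j⁆ =
      (if l = i then rootVec x y h i j else 0) - (if l = j then rootVec x y h i j else 0) := by
  induction j, hij using Nat.le_induction with
  | base => rw [Nat.succ_eq_add_one, rootVec_self_succ]; exact H.hx l i hl hj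
  | succ j hij ih =>
    have hij' : i < j := hij
    rw [rootVec_succ x y h hij', leibniz_lie, ih (by omega), H.hx l j hl hj]
    split_ifs <;> first | omega | simp [-lie_skew]

theorem ChevalleyRel.lie_x_far (H : ChevalleyRel n x y h) {i j k : ℕ} (hk : k + 1 < n)
    (hij : i < j) (hj : j < k) : ⁅x k, rootVec x y h i j⁆ = 0 := by
  induction j, hij using Nat.le_induction with
  | base =>
    rw [Nat.succ_eq_add_one, rootVec_self_succ, ← lie_skew, H.xx i k (by omega) hk hj, neg_zero]
  | succ j hij ih =>
    have hij' : i < j := hij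
    rw [rootVec_succ x y h hij', leibniz_lie, ih (by omega), ← lie_skew (x k) (x j),
      H.xx j k (by omega) hk hj]
    simp

theorem eq_zero_of_eq_neg [Module ℚ A] {a : A} (ha : a = -a) : a = 0 := by
  have h2 : (2 : ℚ) • a = 0 := by
    rw [two_smul]; nth_rewrite 1 [ha]; simp
  simpa using h2

theorem ChevalleyRel.lie_x_up [Module ℚ A] (H : ChevalleyRel n x y h) {i j k : ℕ} (hk : k + 1 < n)
    (hij : i < j) (hj : j < n) : ⁅x k, rootVec x y h i j⁆ =
      (if k + 1 = i then rootVec x y h k j else 0) -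
      (if k = j then rootVec x y h i (k + 1) else 0) := by
  induction j, hij using Nat.le_induction generalizing k with
  | base =>
    rw [Nat.succ_eq_add_one, rootVec_self_succ]
    rcases lt_trichotomy k i with hki | rfl | hki
    · rw [if_neg (show ¬ k = i + 1 by omega)]
      split_ifs with h1
      · subst h1
        rw [rootVec_succ x y h (by omega), rootVec_self_succ]; simp
      · rw [H.xx k i hk hj (by omega)]; simp
    · simp
    · rw [if_neg (show ¬ k + 1 = i by omega), ← lie_skew]
      split_ifs with h1
      · subst h1
        rw [rootVec_succ x y h (by omega), rootVec_self_succ]; simp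
      · rw [H.xx i k hj hk (by omega)]; simp
  | succ j hij ih =>
    have hij' : i < j := hij
    have hjn : j < n := by omega
    rcases Nat.lt_or_ge k (j - 1) with hk1 | hk1
    · -- far below
      rw [if_neg (show ¬ k = j + 1 by omega), rootVec_succ x y h hij', leibniz_lie, ih hk hjn,
        H.xx k j hk hj (by omega), if_neg (show ¬ k = j by omega)]
      split_ifs with h1
      · subst h1
        rw [rootVec_succ x y h (show k < j by omega)]; simp
      · simp
    rcases Nat.lt_or_ge (j + 1) k with hk2 | hk2
    · rw [H.lie_x_far hk (by omega) hk2]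
      rw [if_neg (by omega), if_neg (by omega), sub_zero]
    have hc : k + 1 = j ∨ k = j ∨ k = j + 1 := by omega
    rcases hc with rfl | rfl | rfl
    · rw [if_neg (by omega), if_neg (by omega), sub_zero]
      rcases Nat.eq_or_lt_of_le (show i ≤ k by omega) with rfl | hik
      · rw [rootVec_succ x y h hij', rootVec_self_succ]
        exact H.sx i hj
      · have hb := ih (k := k) hk hjn
        rw [if_neg (by omega), if_neg (by omega), sub_zero] at hb
        have hf := H.lie_x_far (i := i) (j := k) (k := k + 1) hj hik (by omega)
        have hs := H.sx k hj
        rw [rootVec_succ x y h hij']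
        rw [rootVec_succ x y h hik] at hb ⊢
        set u := rootVec x y h i k
        set b := x k
        set c := x (k + 1)
        have huc : ⁅u, c⁆ = 0 := by rw [← lie_skew, hf, neg_zero]
        have e1 : ⁅b, ⁅⁅u, b⁆, c⁆⁆ = ⁅⁅u, b⁆, ⁅b, c⁆⁆ := by
          rw [leibniz_lie, hb, zero_lie, zero_add]
        have e2 : ⁅⁅u, b⁆, c⁆ = ⁅u, ⁅b, c⁆⁆ := by
          rw [leibniz_lie u b c, huc, lie_zero, add_zero]
        have e3 : ⁅b, ⁅u, ⁅b, c⁆⁆⁆ = ⁅⁅b, u⁆, ⁅b, c⁆⁆ := by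
          rw [leibniz_lie, hs, lie_zero, add_zero]
        apply eq_zero_of_eq_neg
        nth_rewrite 1 [e1]
        rw [e2, e3, ← lie_skew b u, neg_lie, neg_neg]
    · rw [if_neg (by omega), if_neg (by omega), sub_zero]
      rw [rootVec_succ x y h hij']
      obtain ⟨j, rfl⟩ : ∃ j, k = j + 1 := ⟨k - 1, by omega⟩
      rcases Nat.eq_or_lt_of_le (show i ≤ j by omega) with rfl | hij2
      · rw [rootVec_self_succ, ← lie_skew (x i) (x (i + 1)), lie_neg, H.sx' i hj, neg_zero]
      · have hf := H.lie_x_far (i := i) (j := j) (k := j + 1) hj hij2 (by omega)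
        have hs := H.sx' j hj
        rw [rootVec_succ x y h hij2]
        set u := rootVec x y h i j
        set b := x j
        set c := x (j + 1)
        have huc : ⁅u, c⁆ = 0 := by rw [← lie_skew, hf, neg_zero]
        have e2 : ⁅⁅u, b⁆, c⁆ = ⁅u, ⁅b, c⁆⁆ := by
          rw [leibniz_lie u b c, huc, lie_zero, add_zero]
        rw [e2, leibniz_lie, hf, zero_lie, zero_add, ← lie_skew b c, lie_neg, hs]
        simp
    · rw [if_neg (by omega), if_pos rfl, zero_sub,
        rootVec_succ x y h (show i < j + 1 by omega), lie_skew]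

theorem ChevalleyRel.lie_y_up [Module ℚ A] (H : ChevalleyRel n x y h) {i j k : ℕ} (hk : k + 1 < n)
    (hij : i < j) (hj : j < n) : ⁅y k, rootVec x y h i j⁆ =
      (if k = i then rootVec x y h (k + 1) j else 0) -
      (if k + 1 = j then rootVec x y h i k else 0) := by
  induction j, hij using Nat.le_induction with
  | base =>
    rw [Nat.succ_eq_add_one, rootVec_self_succ, ← lie_skew, H.xy i k hj hk]
    rcases eq_or_ne i k with rfl | hik
    · simp [rootVec_self]
    · rw [if_neg hik, if_neg hik.symm, if_neg (by omega)]; simp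
  | succ j hij ih =>
    have hij' : i < j := hij
    rw [rootVec_succ x y h hij', leibniz_lie, ih (by omega), ← lie_skew (y k) (x j),
      H.xy j k hj hk]
    rcases eq_or_ne k i with rfl | hki
    · rw [if_pos rfl, if_pos rfl, if_neg (show ¬ j = k by omega),
        if_neg (show ¬ k + 1 = j + 1 by omega), neg_zero, lie_zero, add_zero, sub_lie]
      rcases eq_or_ne (k + 1) j with rfl | hkj
      · rw [if_pos rfl, rootVec_self, rootVec_self, rootVec_self_succ, H.hx _ _ (by omega) hj,
          H.hx _ _ (by omega) hj]
        simp [show ¬ k = k + 1 + 1 by omega]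
      · rw [if_neg hkj, rootVec_succ x y h (show k + 1 < j by omega)]; simp
    · rw [if_neg hki, if_neg hki, zero_sub, zero_sub]
      rcases eq_or_ne k j with rfl | hkj
      · rw [if_pos rfl, if_pos rfl, if_neg (by omega), neg_zero, zero_lie, zero_add, lie_neg,
          lie_skew, sub_lie, H.lie_h_up (by omega) hij' (by omega),
          H.lie_h_up (by omega) hij' (by omega)]
        rw [if_neg (by omega), if_pos rfl, if_neg (by omega), if_neg (by omega)]
        simp
      · rw [if_neg (Ne.symm hkj), if_neg (show ¬ k + 1 = j + 1 by omega), neg_zero, lie_zero,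
          add_zero]
        split_ifs with h1
        · subst h1
          rcases Nat.lt_or_ge i k with hik | hik
          · rw [← lie_skew, lie_neg, neg_neg, H.lie_x_far hj hik (by omega)]
          · omega
        · simp

/-- Brackets with `e i j` are those of matrix units. -/
def IsUnitLike (e : ℕ → ℕ → A) (n i j : ℕ) : Prop :=
  ∀ k l, k < n → l < n → ⁅e i j, e k l⁆ =
    (if j = k then e i l else 0) - (if l = i then e k j else 0)

theorem isUnitLike_trans {e : ℕ → ℕ → A} {i j m : ℕ} (hi : i < n) (hj : j < n) (hm : m < n)
    (him : i ≠ m) (h1 : IsUnitLike e n i j) (h2 : IsUnitLike e n j m) : IsUnitLike e n i m := by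
  have e0 : e i m = ⁅e i j, e j m⁆ := by
    rw [h1 j m hj hm, if_pos rfl, if_neg him.symm, sub_zero]
  intro k l hk hl
  rw [e0, lie_lie, h1 k l hk hl, h2 k l hk hl, lie_sub, lie_sub]
  have a1 : ⁅e i j, if m = k then e j l else 0⁆ =
      if m = k then e i l - (if l = i then e j j else 0) else 0 := by
    split_ifs with h3 h4
    · rw [h1 j l hj hl, if_pos rfl, if_pos h4]
    · rw [h1 j l hj hl, if_pos rfl, if_neg h4]
    · simp
  have a2 : ⁅e i j, if l = j then e k m else 0⁆ =
      if l = j then (if j = k then e i m else 0) else 0 := by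
    split_ifs with h3 h4
    · rw [h1 k m hk hm, if_pos h4, if_neg him.symm, sub_zero]
    · rw [h1 k m hk hm, if_neg h4, if_neg him.symm, sub_zero]
    · simp
  have a3 : ⁅e j m, if j = k then e i l else 0⁆ =
      if j = k then - (if l = j then e i m else 0) else 0 := by
    split_ifs with h3 h4
    · rw [h2 i l hi hl, if_pos h4, if_neg him.symm, zero_sub]
    · rw [h2 i l hi hl, if_neg h4, if_neg him.symm]; simp
    · simp
  have a4 : ⁅e j m, if l = i then e k j else 0⁆ =
      if l = i then (if m = k then e j j else 0) - e k m else 0 := by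
    split_ifs with h3 h4
    · rw [h2 k j hk hj, if_pos h4, if_pos rfl]
    · rw [h2 k j hk hj, if_neg h4, if_pos rfl]
    · simp
  rw [a1, a2, a3, a4]
  clear a1 a2 a3 a4 e0 h1 h2
  split_ifs <;> simp_all

theorem ChevalleyRel.isUnitLike_x [Module ℚ A] (H : ChevalleyRel n x y h) {k : ℕ} (hk : k + 1 < n) :
    IsUnitLike (rootVec x y h) n k (k + 1) := by
  intro i j hi hj
  rw [rootVec_self_succ]
  rcases lt_trichotomy i j with hij | rfl | hij
  · rw [H.lie_x_up hk hij hj]; simp only [eq_comm]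
  · rw [rootVec_self, ← lie_skew, H.hx i k hi hk]
    rcases eq_or_ne i k with rfl | h1
    · simp [rootVec_self_succ]
    · rcases eq_or_ne i (k + 1) with rfl | h2
      · simp [rootVec_self_succ]
      · simp [h1, h2, Ne.symm h2]
  · have := H.swap.lie_y_up hk hij hi
    simp only [rootVec_swap, neg_lie, lie_neg, neg_neg] at this
    rw [this]
    rcases eq_or_ne k j with rfl | h1
    · rcases eq_or_ne (k + 1) i with rfl | h2
      · simp; abel
      · simp [h2]
    · rcases eq_or_ne (k + 1) i with rfl | h2
      · simp [h1, Ne.symm h1]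
      · simp [h1, h2, Ne.symm h1]

theorem ChevalleyRel.isUnitLike_y [Module ℚ A] (H : ChevalleyRel n x y h) {k : ℕ} (hk : k + 1 < n) :
    IsUnitLike (rootVec x y h) n (k + 1) k := by
  intro i j hi hj
  have := H.swap.isUnitLike_x hk j i hj hi
  simp only [rootVec_swap, neg_lie, lie_neg, neg_neg] at this
  rw [this]
  rcases eq_or_ne k i with rfl | h1
  · rcases eq_or_ne (k + 1) j with rfl | h2
    · simp; abel
    · simp [h2, Ne.symm h2]
  · rcases eq_or_ne (k + 1) j with rfl | h2
    · simp [h1, Ne.symm h1]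
    · simp [h1, h2, Ne.symm h1, Ne.symm h2]

theorem ChevalleyRel.isUnitLike_h [Module ℚ A] (H : ChevalleyRel n x y h) {k : ℕ} (hk : k < n) :
    IsUnitLike (rootVec x y h) n k k := by
  intro i j hi hj
  rw [rootVec_self]
  rcases lt_trichotomy i j with hij | rfl | hij
  · rw [H.lie_h_up hk hij hj]
    split_ifs <;> first | omega | (subst_vars; simp)
  · rw [rootVec_self, H.hh k i hk hi]
    split_ifs <;> first | omega | (subst_vars; simp [rootVec_self])
  · have := H.swap.lie_h_up hk hij hi
    simp only [rootVec_swap, neg_lie, lie_neg, neg_neg] at this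
    rw [this]
    split_ifs <;> first | omega | (subst_vars; simp)

theorem ChevalleyRel.isUnitLike [Module ℚ A] (H : ChevalleyRel n x y h) {i j : ℕ} (hi : i < n)
    (hj : j < n) : IsUnitLike (rootVec x y h) n i j := by
  rcases lt_trichotomy i j with hij | rfl | hij
  · induction j, hij using Nat.le_induction with
    | base => exact H.isUnitLike_x hj
    | succ j hij ih =>
      exact isUnitLike_trans hi (by omega) hj (by omega) (ih (by omega)) (H.isUnitLike_x hj)
  · exact H.isUnitLike_h hi
  · induction i, hij using Nat.le_induction with
    | base => exact H.isUnitLike_y hi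
    | succ i hij ih =>
      exact isUnitLike_trans hi (by omega) hj (by omega) (H.isUnitLike_y hi) (ih (by omega))

end

/-- The linear map on `gl(n)` with `E_{i+1,j+1} ↦ rootVec x y h i j`. -/
def glMap {A : Type*} [LieRing A] [Module ℂ A] (n : ℕ) (x y h : ℕ → A) :
    Matrix (Fin n) (Fin n) ℂ →ₗ[ℂ] A where
  toFun M := ∑ i : Fin n, ∑ j : Fin n, M i j • rootVec x y h i j
  map_add' M N := by simp [add_smul, Finset.sum_add_distrib]
  map_smul' c M := by simp [mul_smul, Finset.smul_sum]

theorem glMap_single {A : Type*} [LieRing A] [Module ℂ A] (n : ℕ) (x y h : ℕ → A) (i j : Fin n)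
    (c : ℂ) : glMap n x y h (Matrix.single i j c) = c • rootVec x y h i j := by
  simp only [glMap, LinearMap.coe_mk, AddHom.coe_mk, Matrix.single_apply]
  rw [Finset.sum_eq_single i, Finset.sum_eq_single j]
  · simp
  · intro b _ hb; simp [Ne.symm hb]
  · simp
  · intro b _ hb; simp [Ne.symm hb]
  · simp

theorem glMap_lie {A : Type*} [LieRing A] [LieAlgebra ℂ A] {n : ℕ} {x y h : ℕ → A}
    (H : ChevalleyRel n x y h) (M N : Matrix (Fin n) (Fin n) ℂ) :
    glMap n x y h ⁅M, N⁆ = ⁅glMap n x y h M, glMap n x y h N⁆ := by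
  let _ : Module ℚ A := Module.compHom A (algebraMap ℚ ℂ)
  induction M using Matrix.induction_on' with
  | h_zero => simp
  | h_add p q hp hq => rw [add_lie, map_add, map_add, add_lie, hp, hq]
  | h_std_basis i j a =>
    induction N using Matrix.induction_on' with
    | h_zero => simp
    | h_add p q hp hq => rw [lie_add, map_add, map_add, lie_add, hp, hq]
    | h_std_basis k l b =>
      rw [glMap_single, glMap_single, smul_lie, lie_smul, H.isUnitLike i.2 j.2 k l k.2 l.2,
        Ring.lie_def, map_sub]
      have e1 : ∀ (i j k l : Fin n) (a b : ℂ), glMap n x y h (Matrix.single i j a * Matrix.single k l b) =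
          if (j : ℕ) = k then (a * b) • rootVec x y h i l else 0 := by
        intro i j k l a b
        split_ifs with hjk
        · obtain rfl := Fin.ext hjk
          rw [Matrix.single_mul_single_same, glMap_single]
        · rw [Matrix.single_mul_single_of_ne _ _ _ _ (fun h => hjk (congrArg _ h)), map_zero]
      rw [e1, e1, smul_sub, smul_sub]
      congr 1
      · split_ifs <;> simp [mul_smul]
      · split_ifs <;> simp [mul_smul, smul_comm a b]


/-! ## The Serre relations for two adjacent rows -/

theorem serre_expand {𝓡 : Type*} [Ring 𝓡] (I J : Finset ℕ) (f g : ℕ → 𝓡) :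
    ⁅∑ i ∈ I, f i, ⁅∑ i ∈ I, f i, ∑ m ∈ J, g m⁆⁆ = ∑ m ∈ J, ∑ i ∈ I, ∑ j ∈ I,
        (f j * (f i * g m) - f j * (g m * f i) - f j * (g m * f i) + g m * (f j * f i)) := by
  simp only [Finset.sum_add_distrib, Finset.sum_sub_distrib, ← Finset.mul_sum, ← Finset.sum_mul,
      Ring.lie_def]
  noncomm_ring

section abs
variable {B : Type*} {I J : Finset ℕ} {s t : ℕ → B → B} {p q : ℕ → B → ℂ} {a b : ℕ → B → ℂ} {ε : ℂ}

theorem sum_sum_eq_zero {V : Type*} [AddCommGroup V] [Module ℂ V] (I : Finset ℕ) (f : ℕ → ℕ → V)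
    (hf : ∀ i ∈ I, ∀ j ∈ I, f i j = - f j i) : ∑ i ∈ I, ∑ j ∈ I, f i j = 0 := by
  have h1 : ∑ i ∈ I, ∑ j ∈ I, f i j = - ∑ i ∈ I, ∑ j ∈ I, f i j := by
    nth_rewrite 1 [Finset.sum_comm]
    rw [← Finset.sum_neg_distrib]
    refine Finset.sum_congr rfl fun i hi => ?_
    rw [← Finset.sum_neg_distrib]
    exact Finset.sum_congr rfl fun j hj => hf j hj i hi
  have h2 : (2 : ℂ) • ∑ i ∈ I, ∑ j ∈ I, f i j = 0 := by
    rw [two_smul]; nth_rewrite 1 [h1]; simp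
  simpa using h2

/-- Two adjacent rows: `p` weights of shifts `s` in the first row and `q` weights of shifts `t`
in the second one. -/
structure RowPair (I J : Finset ℕ) (s t : ℕ → B → B) (p q a b : ℕ → B → ℂ) (ε : ℂ) : Prop where
  ss : ∀ i ∈ I, ∀ j ∈ I, ∀ R, s i (s j R) = s j (s i R)
  tt : ∀ i ∈ J, ∀ j ∈ J, ∀ R, t i (t j R) = t j (t i R)
  st : ∀ i ∈ I, ∀ j ∈ J, ∀ R, s i (t j R) = t j (s i R)
  as : ∀ i ∈ I, ∀ j ∈ I, ∀ R, a i (s j R) = a i R + if i = j then ε else 0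
  at' : ∀ i ∈ I, ∀ j ∈ J, ∀ R, a i (t j R) = a i R
  bs : ∀ i ∈ J, ∀ j ∈ I, ∀ R, b i (s j R) = b i R
  bt : ∀ i ∈ J, ∀ j ∈ J, ∀ R, b i (t j R) = b i R + if i = j then ε else 0
  ga : ∀ i ∈ I, ∀ j ∈ I, i ≠ j → ∀ R, a i R - a j R ≠ 0
  gb : ∀ i ∈ J, ∀ j ∈ J, i ≠ j → ∀ R, b i R - b j R ≠ 0
  qs : ∀ m ∈ J, ∀ i ∈ I, ∀ R, q m (s i R) = q m R
  qt : ∀ m ∈ J, ∀ l ∈ J, m ≠ l → ∀ R, q m (t l R) * (b m R - b l R - ε) = q m R * (b m R - b l R)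
  ps : ∀ i ∈ I, ∀ j ∈ I, i ≠ j → ∀ R, p i (s j R) * (a i R - a j R - ε) = p i R * (a i R - a j R)
  pt : ∃ c : ℕ → B → ℂ, (∀ i ∈ I, ∀ R, p i R = c i R * ∏ m ∈ J, (a i R - b m R)) ∧
    ∀ i ∈ I, ∀ m ∈ J, ∀ R, c i (t m R) = c i R

namespace RowPair

theorem ga' (H : RowPair I J s t p q a b ε) {i j : ℕ} (hi : i ∈ I) (hj : j ∈ I) (hij : i ≠ j) (R : B) : a i R - a j R - ε ≠ 0 := by
  have := H.ga i hi j hj hij (s j R)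
  rw [H.as i hi j hj, H.as j hj j hj, if_neg hij, if_pos rfl] at this
  intro h; apply this; linear_combination h

theorem gb' (H : RowPair I J s t p q a b ε) {i j : ℕ} (hi : i ∈ J) (hj : j ∈ J) (hij : i ≠ j) (R : B) : b i R - b j R - ε ≠ 0 := by
  have := H.gb i hi j hj hij (t j R)
  rw [H.bt i hi j hj, H.bt j hj j hj, if_neg hij, if_pos rfl] at this
  intro h; apply this; linear_combination h

theorem pt1 (H : RowPair I J s t p q a b ε) {i m : ℕ} (hi : i ∈ I) (hm : m ∈ J) (R : B) : ∃ c, p i R = c * (a i R - b m R) ∧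
    p i (t m R) = c * (a i R - b m R - ε) ∧ p i (t m (t m R)) = c * (a i R - b m R - 2 * ε) := by
  obtain ⟨c, h1, h2⟩ := H.pt
  refine ⟨c i R * ∏ l ∈ J.erase m, (a i R - b l R), ?_, ?_, ?_⟩
  · rw [h1 i hi, ← Finset.mul_prod_erase _ _ hm]; ring
  · rw [h1 i hi, ← Finset.mul_prod_erase _ _ hm, h2 i hi m hm, H.at' i hi m hm, H.bt m hm m hm,
      if_pos rfl, Finset.prod_congr rfl (g := fun l => a i R - b l R)]
    · ring
    · intro l hl
      rw [H.bt l (Finset.mem_of_mem_erase hl) m hm, if_neg (Finset.ne_of_mem_erase hl), add_zero]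
  · rw [h1 i hi, ← Finset.mul_prod_erase _ _ hm, h2 i hi m hm, H.at' i hi m hm, H.bt m hm m hm,
      h2 i hi m hm, H.at' i hi m hm, H.bt m hm m hm,
      if_pos rfl, Finset.prod_congr rfl (g := fun l => a i R - b l R)]
    · ring
    · intro l hl
      rw [H.bt l (Finset.mem_of_mem_erase hl) m hm, H.bt l (Finset.mem_of_mem_erase hl) m hm,
        if_neg (Finset.ne_of_mem_erase hl), add_zero, add_zero]

theorem pt2 (H : RowPair I J s t p q a b ε) {i m l : ℕ} (hi : i ∈ I) (hm : m ∈ J) (hl : l ∈ J) (hml : m ≠ l) (R : B) :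
    ∃ c, p i R = c * ((a i R - b m R) * (a i R - b l R)) ∧
    p i (t m R) = c * ((a i R - b m R - ε) * (a i R - b l R)) ∧
    p i (t l R) = c * ((a i R - b m R) * (a i R - b l R - ε)) ∧
    p i (t l (t m R)) = c * ((a i R - b m R - ε) * (a i R - b l R - ε)) := by
  obtain ⟨c, h1, h2⟩ := H.pt
  have hl' : l ∈ J.erase m := Finset.mem_erase.2 ⟨hml.symm, hl⟩
  have key : ∀ r ∈ (J.erase m).erase l, r ∈ J ∧ r ≠ m ∧ r ≠ l := by
    intro r hr; simp at hr; tauto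
  refine ⟨c i R * ∏ r ∈ (J.erase m).erase l, (a i R - b r R), ?_, ?_, ?_, ?_⟩ <;>
    rw [h1 i hi, ← Finset.mul_prod_erase _ _ hm, ← Finset.mul_prod_erase _ _ hl']
  · ring
  · rw [h2 i hi m hm, H.at' i hi m hm, H.bt m hm m hm, H.bt l hl m hm,
      if_pos rfl, if_neg hml.symm, Finset.prod_congr rfl (g := fun l => a i R - b l R)]
    · ring
    · intro r hr
      obtain ⟨hr1, hr2, hr3⟩ := key r hr
      rw [H.bt r hr1 m hm, if_neg hr2, add_zero]
  · rw [h2 i hi l hl, H.at' i hi l hl, H.bt m hm l hl, H.bt l hl l hl,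
      if_pos rfl, if_neg hml, Finset.prod_congr rfl (g := fun l => a i R - b l R)]
    · ring
    · intro r hr
      obtain ⟨hr1, hr2, hr3⟩ := key r hr
      rw [H.bt r hr1 l hl, if_neg hr3, add_zero]
  · rw [h2 i hi l hl, H.at' i hi l hl, H.bt m hm l hl, H.bt l hl l hl,
      h2 i hi m hm, H.at' i hi m hm, H.bt m hm m hm, H.bt l hl m hm,
      if_pos rfl, if_pos rfl, if_neg hml, if_neg hml.symm,
      Finset.prod_congr rfl (g := fun l => a i R - b l R)]
    · ring
    · intro r hr
      obtain ⟨hr1, hr2, hr3⟩ := key r hr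
      rw [H.bt r hr1 l hl, if_neg hr3, H.bt r hr1 m hm, if_neg hr2, add_zero, add_zero]

theorem serre1 (H : RowPair I J s t p q a b ε) : ⁅∑ i ∈ I, wShift (s i) (p i), ⁅∑ i ∈ I, wShift (s i) (p i),
    ∑ m ∈ J, wShift (t m) (q m)⁆⁆ = 0 := by
  refine (serre_expand  I J (fun i => wShift (s i) (p i))
    (fun m => wShift (t m) (q m))).trans ?_
  refine hom_ext fun R => ?_
  simp only [LinearMap.sum_apply, LinearMap.zero_apply,
    LinearMap.sub_apply, LinearMap.add_apply, Module.End.mul_apply, wShift_vec]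
  refine Finset.sum_eq_zero fun m hm => sum_sum_eq_zero _ _ fun i hi j hj => ?_
  simp only [H.qs m hm i hi, H.qs m hm j hj]
  rw [H.st i hi m hm, H.st j hj m hm, H.st j hj m hm, H.st i hi m hm, H.ss j hj i hi]
  simp only [← vec_add, ← vec_sub, ← vec_neg]
  congr 1
  rcases eq_or_ne i j with rfl | hij
  · obtain ⟨c, h1, h2, -⟩ := H.pt1 hi hm R
    obtain ⟨d, h3, h4, -⟩ := H.pt1 hi hm (s i R)
    rw [H.as i hi i hi, if_pos rfl, H.bs m hm i hi] at h3 h4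
    rw [h4, h3, h2, h1]
    ring
  · obtain ⟨c, h1, h2, -⟩ := H.pt1 hi hm R
    obtain ⟨d, h3, h4, -⟩ := H.pt1 hj hm R
    have g1 := H.ga i hi j hj hij R
    have g2 := H.ga' hi hj hij R
    have g3 := H.ga' hj hi hij.symm R
    have k1 := H.ps i hi j hj hij R
    have k2 := H.ps j hj i hi hij.symm R
    have k3 := H.ps i hi j hj hij (t m R)
    have k4 := H.ps j hj i hi hij.symm (t m R)
    rw [H.at' i hi m hm, H.at' j hj m hm] at k3 k4
    rw [H.st j hj m hm] at k3
    rw [H.st i hi m hm] at k4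
    rw [h1, ← eq_div_iff g2] at k1
    rw [h3, ← eq_div_iff g3] at k2
    rw [h2, ← eq_div_iff g2] at k3
    rw [h4, ← eq_div_iff g3] at k4
    rw [k1, k2, k3, k4, h1, h2, h3, h4]
    field_simp
    ring

theorem serre2 (H : RowPair I J s t p q a b ε) : ⁅∑ m ∈ J, wShift (t m) (q m), ⁅∑ m ∈ J, wShift (t m) (q m),
    ∑ i ∈ I, wShift (s i) (p i)⁆⁆ = 0 := by
  refine (serre_expand  J I (fun m => wShift (t m) (q m))
    (fun i => wShift (s i) (p i))).trans ?_
  refine hom_ext fun R => ?_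
  simp only [LinearMap.sum_apply, LinearMap.zero_apply,
    LinearMap.sub_apply, LinearMap.add_apply, Module.End.mul_apply, wShift_vec]
  refine Finset.sum_eq_zero fun i hi => sum_sum_eq_zero _ _ fun m hm l hl => ?_
  rw [← H.st i hi m hm, ← H.st i hi l hl, ← H.st i hi m hm, ← H.st i hi l hl]
  simp only [H.qs m hm i hi, H.qs l hl i hi]
  rw [H.st i hi m hm, H.st i hi l hl, H.st i hi l hl, H.st i hi m hm, H.tt l hl m hm]
  simp only [← vec_add, ← vec_sub, ← vec_neg]
  congr 1
  rcases eq_or_ne m l with rfl | hml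
  · obtain ⟨c, h1, h2, h3⟩ := H.pt1 hi hm R
    rw [h3, h2, h1]
    ring
  · obtain ⟨c, h1, h2, h3, h4⟩ := H.pt2 hi hm hl hml R
    have g1 := H.gb m hm l hl hml R
    have g2 := H.gb' hm hl hml R
    have g3 := H.gb' hl hm hml.symm R
    have k1 := H.qt m hm l hl hml R
    have k2 := H.qt l hl m hm hml.symm R
    rw [← eq_div_iff g2] at k1
    rw [← eq_div_iff g3] at k2
    have h5 := h4
    rw [H.tt l hl m hm] at h5
    simp only [k1, k2, h4, h5, h1, h2, h3]
    field_simp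
    ring
end RowPair

end abs

/-! ## The Gelfand--Tsetlin operators satisfy the relations of `gl(n)` -/

theorem residue_sum {σ τ : Type*} [DecidableEq σ] (S : Finset σ) (T : Finset τ) (v : σ → ℂ) (β : τ → ℂ)
    (hv : Set.InjOn v S) (hc : #T = #S) (h0 : 0 < #S) :
    ∑ i ∈ S, (∏ m ∈ T, (v i - β m)) / ∏ j ∈ S.erase i, (v i - v j) =
      ∑ i ∈ S, v i - ∑ m ∈ T, β m := by
  classical
  set P : Polynomial ℂ := ∏ m ∈ T, (Polynomial.X - Polynomial.C (β m))
  set Q : Polynomial ℂ := ∏ i ∈ S, (Polynomial.X - Polynomial.C (v i))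
  have hPm : P.Monic := Polynomial.monic_prod_X_sub_C β T
  have hQm : Q.Monic := Polynomial.monic_prod_X_sub_C v S
  have hP : P.degree = #S := by
    rw [Polynomial.degree_eq_natDegree hPm.ne_zero, Polynomial.natDegree_finsetProd_X_sub_C_eq_card,
      hc]
  have hQ : Q.degree = #S := by
    rw [Polynomial.degree_eq_natDegree hQm.ne_zero, Polynomial.natDegree_finsetProd_X_sub_C_eq_card]
  have hd : (P - Q).degree < #S := by
    rw [← hP]
    exact Polynomial.degree_sub_lt_left (hP.trans hQ.symm) hPm.ne_zero (by rw [hPm, hQm])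
  have := Lagrange.coeff_eq_sum hv hd
  rw [Polynomial.coeff_sub, Polynomial.prod_X_sub_C_coeff_card_pred S v h0] at this
  rw [← hc, Polynomial.prod_X_sub_C_coeff_card_pred T β (hc ▸ h0)] at this
  rw [show ∑ i ∈ S, v i - ∑ m ∈ T, β m = -∑ i ∈ T, β i - -∑ i ∈ S, v i by ring, this]
  refine Finset.sum_congr rfl fun i hi => ?_
  rw [Polynomial.eval_sub, Polynomial.eval_prod, Polynomial.eval_prod]
  rw [Finset.prod_eq_zero (i := i) hi (by simp)]
  simp

theorem diag_identity {I M N : Finset ℕ} (l b p : ℕ → ℂ) (hI : 0 < #I) (hc : #M + #N = 2 * #I)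
    (hl : ∀ i ∈ I, ∀ j ∈ I, i ≠ j → ∀ m : ℤ, l i - l j ≠ m) :
    ∑ i ∈ I, ((∏ m ∈ M, (l i - b m)) * (∏ j ∈ N, (l i + 1 - p j)) /
        ((∏ j ∈ I.erase i, (l i - l j)) * ∏ j ∈ I.erase i, (l i + 1 - l j)) -
      (∏ m ∈ M, (l i - 1 - b m)) * (∏ j ∈ N, (l i - p j)) /
        ((∏ j ∈ I.erase i, (l i - l j)) * ∏ j ∈ I.erase i, (l i - 1 - l j))) =
      2 * ∑ i ∈ I, l i - #I - ∑ m ∈ M, b m - ∑ j ∈ N, p j + #N := by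
  have h := residue_sum (I.disjSum I) (M.disjSum N) (Sum.elim l fun i => l i - 1)
    (Sum.elim b fun i => p i - 1) ?_
    (by rw [Finset.card_disjSum, Finset.card_disjSum]; omega) (by rw [Finset.card_disjSum]; omega)
  · simp only [Finset.sum_disjSum, Finset.prod_disjSum, Sum.elim_inl, Sum.elim_inr,
      Finset.sum_sub_distrib, Finset.sum_const, nsmul_eq_mul, mul_one] at h
    have e1 : ∀ i, (I.disjSum I).erase (Sum.inl i) = (I.erase i).disjSum I := by
      intro i; ext (x | x) <;> simp
    have e2 : ∀ i, (I.disjSum I).erase (Sum.inr i) = I.disjSum (I.erase i) := by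
      intro i; ext (x | x) <;> simp
    simp only [e1, e2, Finset.prod_disjSum, Sum.elim_inl, Sum.elim_inr] at h
    rw [Finset.sum_sub_distrib]
    rw [show 2 * ∑ i ∈ I, l i - #I - ∑ m ∈ M, b m - ∑ j ∈ N, p j + #N =
      ∑ i ∈ I, l i + (∑ i ∈ I, l i - #I) - (∑ m ∈ M, b m + (∑ j ∈ N, p j - #N)) by ring, ← h,
      sub_eq_add_neg, ← Finset.sum_neg_distrib]
    congr 1
    · refine Finset.sum_congr rfl fun i hi => ?_
      rw [← Finset.mul_prod_erase I (fun x => l i - (l x - 1)) hi]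
      rw [Finset.prod_congr rfl (fun j _ => show l i - (p j - 1) = l i + 1 - p j by ring),
        Finset.prod_congr rfl (fun j _ => show l i - (l j - 1) = l i + 1 - l j by ring)]
      congr 1
      ring
    · refine Finset.sum_congr rfl fun i hi => ?_
      rw [← Finset.mul_prod_erase I (fun x => l i - 1 - l x) hi]
      rw [Finset.prod_congr rfl (fun j _ => show l i - 1 - (p j - 1) = l i - p j by ring),
        Finset.prod_congr rfl (fun j _ => show l i - 1 - (l j - 1) = l i - l j by ring)]
      rw [← div_neg]
      congr 1
      ring
  · rintro (i | i) hi (j | j) hj hij <;>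
      simp only [Finset.mem_coe, Finset.inl_mem_disjSum, Finset.inr_mem_disjSum, Sum.elim_inl,
        Sum.elim_inr] at hi hj hij
    · by_contra hne
      exact hl i hi j hj (fun h => hne (congrArg _ h)) 0 (by rw [hij]; simp)
    · exfalso
      rcases eq_or_ne i j with rfl | hne
      · exact one_ne_zero (α := ℂ) (by linear_combination hij)
      · exact hl i hi j hj hne (-1) (by rw [hij]; push_cast; ring)
    · exfalso
      rcases eq_or_ne i j with rfl | hne
      · exact one_ne_zero (α := ℂ) (by linear_combination -hij)
      · exact hl i hi j hj hne 1 (by rw [← hij]; push_cast; ring)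
    · by_contra hne
      exact hl i hi j hj (fun h => hne (congrArg _ h)) 0 (by
        push_cast; linear_combination hij)

section
variable {n : ℕ} {L : Tableau n}

theorem shift_comm (R : tableaux L) (k i l j : ℕ) (e f : ℤ) :
    shift (shift R k i e) l j f = shift (shift R l j f) k i e := by
  apply Subtype.ext; funext p; simp only [shift]; ring

theorem shift_cancel (R : tableaux L) (k i : ℕ) {e f : ℤ} (h : e + f = 0) :
    shift (shift R k i e) k i f = R := by
  apply Subtype.ext; funext p; simp only [shift]
  split_ifs
  · have : (e : ℂ) + f = 0 := by exact_mod_cast h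
    rw [add_assoc, this, add_zero]
  · simp

theorem entry_shift (R : tableaux L) {k i : ℕ} (e : ℤ) (hk : k < n) (hi : i ∈ Icc 1 k) (k' j : ℕ) :
    entry (shift R k i e).1 k' j = entry R.1 k' j + if k' = k ∧ j = i then (e : ℂ) else 0 := by
  simp only [mem_Icc] at hi
  unfold entry shift
  by_cases h : 1 ≤ j ∧ j ≤ k' ∧ k' ≤ n
  · simp [h, hk]
  · rw [dif_neg h, dif_neg h, if_neg, add_zero]
    rintro ⟨rfl, rfl⟩; apply h; omega

theorem entry_shift_row (R : tableaux L) {k i k' j : ℕ} (e : ℤ) (hk : k < n) (hi : i ∈ Icc 1 k)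
    (h : k' ≠ k) : entry (shift R k i e).1 k' j = entry R.1 k' j := by
  rw [entry_shift R e hk hi, if_neg (fun h' => h h'.1), add_zero]

theorem entry_shift_ne (R : tableaux L) {k i j : ℕ} (e : ℤ) (hk : k < n) (hi : i ∈ Icc 1 k)
    (h : j ≠ i) : entry (shift R k i e).1 k j = entry R.1 k j := by
  rw [entry_shift R e hk hi, if_neg (fun h' => h h'.2), add_zero]

theorem entry_shift_self (R : tableaux L) {k i : ℕ} (e : ℤ) (hk : k < n) (hi : i ∈ Icc 1 k) :
    entry (shift R k i e).1 k i = entry R.1 k i + e := by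
  rw [entry_shift R e hk hi, if_pos ⟨rfl, rfl⟩]

theorem IsGeneric.mem (hL : IsGeneric L) (R : tableaux L) : IsGeneric R.1 := by
  obtain ⟨z, hz, hR⟩ := R.2
  have he : ∀ k i, ∃ m : ℤ, entry R.1 k i = entry L k i + m := by
    intro k i
    unfold entry
    split_ifs with h
    · exact ⟨_, hR _⟩
    · exact ⟨0, by simp⟩
  intro k i j hk hi hj hij m hm
  obtain ⟨a, ha⟩ := he k i
  obtain ⟨b, hb⟩ := he k j
  refine hL k i j hk hi hj hij (m - a + b) ?_
  rw [ha, hb] at hm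
  push_cast
  linear_combination hm

/-- The common denominator in the Gelfand--Tsetlin formulas. -/
def den (R : Tableau n) (k i : ℕ) : ℂ := ∏ j ∈ (Icc 1 k).erase i, (entry R k i - entry R k j)

theorem den_shift_row (R : tableaux L) {k i k' j : ℕ} (e : ℤ) (hk : k < n) (hi : i ∈ Icc 1 k)
    (h : k' ≠ k) : den (shift R k i e).1 k' j = den R.1 k' j := by
  unfold den; simp only [entry_shift_row R e hk hi h]

theorem den_shift_ne (R : tableaux L) {k i j : ℕ} (e : ℤ) (hk : k < n) (hi : i ∈ Icc 1 k)
    (h : j ≠ i) :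
    den (shift R k i e).1 k j * (entry R.1 k j - entry R.1 k i) =
      den R.1 k j * (entry R.1 k j - entry R.1 k i - e) := by
  have him : i ∈ (Icc 1 k).erase j := mem_erase.2 ⟨h.symm, hi⟩
  unfold den
  rw [← mul_prod_erase _ _ him, ← mul_prod_erase _ _ him, entry_shift_self R e hk hi,
    entry_shift_ne R e hk hi h, Finset.prod_congr rfl
      (g := fun l => entry R.1 k j - entry R.1 k l)]
  · ring
  · intro l hl
    rw [entry_shift_ne R e hk hi (ne_of_mem_erase hl)]

theorem IsGeneric.sub_ne (hL : IsGeneric L) (R : tableaux L) {k i j : ℕ} (hk : k < n)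
    (hi : i ∈ Icc 1 k) (hj : j ∈ Icc 1 k) (h : i ≠ j) (m : ℤ) :
    entry R.1 k i - entry R.1 k j - m ≠ 0 := fun h' =>
  hL.mem R k i j hk hi hj h m (sub_eq_zero.1 h')

theorem IsGeneric.sub_ne' (hL : IsGeneric L) (R : tableaux L) {k i j : ℕ} (hk : k < n)
    (hi : i ∈ Icc 1 k) (hj : j ∈ Icc 1 k) (h : i ≠ j) :
    entry R.1 k i - entry R.1 k j ≠ 0 := by
  simpa using hL.sub_ne R hk hi hj h 0

theorem IsGeneric.den_ne (hL : IsGeneric L) (R : tableaux L) {k i : ℕ} (hk : k < n)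
    (hi : i ∈ Icc 1 k) : den R.1 k i ≠ 0 := by
  rw [den, Finset.prod_ne_zero_iff]
  intro j hj
  exact hL.sub_ne' R hk hi (mem_of_mem_erase hj) (ne_of_mem_erase hj).symm

theorem IsGeneric.inv_den_shift_ne (hL : IsGeneric L) (R : tableaux L) {k i j : ℕ} (e : ℤ)
    (hk : k < n) (hi : i ∈ Icc 1 k) (hj : j ∈ Icc 1 k) (h : j ≠ i) :
    (den (shift R k i e).1 k j)⁻¹ * (entry R.1 k j - entry R.1 k i - e) =
      (den R.1 k j)⁻¹ * (entry R.1 k j - entry R.1 k i) := by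
  have h1 := hL.den_ne R hk hj
  have h2 := hL.den_ne (shift R k i e) hk hj
  have := den_shift_ne R e hk hi h
  field_simp
  linear_combination -this

theorem upCoeff_eq (R : Tableau n) (k i : ℕ) : upCoeff R k i =
    -(den R k i)⁻¹ * ∏ j ∈ Icc 1 (k + 1), (entry R k i - entry R (k + 1) j) := by
  unfold upCoeff den; rw [div_eq_mul_inv]; ring

theorem downCoeff_eq (R : Tableau n) (k i : ℕ) : downCoeff R k i =
    (den R k i)⁻¹ * ∏ j ∈ Icc 1 (k - 1), (entry R k i - entry R (k - 1) j) := by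
  unfold downCoeff den; rw [div_eq_mul_inv]; ring

theorem upCoeff_shift_row (R : tableaux L) {k i k' j : ℕ} (e : ℤ) (hk : k < n) (hi : i ∈ Icc 1 k)
    (h : k' ≠ k) (h' : k' + 1 ≠ k) : upCoeff (shift R k i e).1 k' j = upCoeff R.1 k' j := by
  rw [upCoeff_eq, upCoeff_eq, den_shift_row R e hk hi h]
  simp only [entry_shift_row R e hk hi h, entry_shift_row R e hk hi h']

theorem downCoeff_shift_row (R : tableaux L) {k i k' j : ℕ} (e : ℤ) (hk : k < n)
    (hi : i ∈ Icc 1 k) (h : k' ≠ k) (h' : k' - 1 ≠ k) :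
    downCoeff (shift R k i e).1 k' j = downCoeff R.1 k' j := by
  rw [downCoeff_eq, downCoeff_eq, den_shift_row R e hk hi h]
  simp only [entry_shift_row R e hk hi h, entry_shift_row R e hk hi h']

theorem IsGeneric.upCoeff_shift_ne (hL : IsGeneric L) (R : tableaux L) {k i j : ℕ} (e : ℤ)
    (hk : k < n) (hi : i ∈ Icc 1 k) (hj : j ∈ Icc 1 k) (h : j ≠ i) :
    upCoeff (shift R k i e).1 k j * (entry R.1 k j - entry R.1 k i - e) =
      upCoeff R.1 k j * (entry R.1 k j - entry R.1 k i) := by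
  have := hL.inv_den_shift_ne R e hk hi hj h
  rw [upCoeff_eq, upCoeff_eq]
  simp only [entry_shift_row R e hk hi (Nat.succ_ne_self k), entry_shift_ne R e hk hi h]
  linear_combination (-∏ x ∈ Icc 1 (k + 1), (entry R.1 k j - entry R.1 (k + 1) x)) * this

theorem IsGeneric.downCoeff_shift_ne (hL : IsGeneric L) (R : tableaux L) {k i j : ℕ} (e : ℤ)
    (hk : k < n) (hi : i ∈ Icc 1 k) (hj : j ∈ Icc 1 k) (h : j ≠ i) :
    downCoeff (shift R k i e).1 k j * (entry R.1 k j - entry R.1 k i - e) =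
      downCoeff R.1 k j * (entry R.1 k j - entry R.1 k i) := by
  have := hL.inv_den_shift_ne R e hk hi hj h
  have hk1 : k - 1 ≠ k := by simp only [mem_Icc] at hi; omega
  rw [downCoeff_eq, downCoeff_eq]
  simp only [entry_shift_row R e hk hi hk1, entry_shift_ne R e hk hi h]
  linear_combination (∏ x ∈ Icc 1 (k - 1), (entry R.1 k j - entry R.1 (k - 1) x)) * this

theorem rowPair_up (hL : IsGeneric L) {k : ℕ} (hk : k + 1 < n) :
    RowPair (B := tableaux L) (Icc 1 k) (Icc 1 (k + 1)) (fun i R => shift R k i 1)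
      (fun i R => shift R (k + 1) i 1) (fun i R => upCoeff R.1 k i)
      (fun i R => upCoeff R.1 (k + 1) i) (fun i R => entry R.1 k i)
      (fun i R => entry R.1 (k + 1) i) 1 where
  ss i _ j _ R := shift_comm R k j k i 1 1
  tt i _ j _ R := shift_comm R (k + 1) j (k + 1) i 1 1
  st i _ j _ R := shift_comm R (k + 1) j k i 1 1
  as i hi j hj R := by simp [entry_shift R 1 (show k < n by omega) hj]
  at' i hi j hj R := by simp [entry_shift R 1 hk hj]
  bs i hi j hj R := by simp [entry_shift R 1 (show k < n by omega) hj]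
  bt i hi j hj R := by simp [entry_shift R 1 hk hj]
  ga i hi j hj h R := hL.sub_ne' R (by omega) hi hj h
  gb i hi j hj h R := hL.sub_ne' R hk hi hj h
  qs m hm i hi R := upCoeff_shift_row R 1 (by omega) hi (by omega) (by omega)
  qt m hm l hl h R := by simpa using hL.upCoeff_shift_ne R 1 hk hl hm h
  ps i hi j hj h R := by simpa using hL.upCoeff_shift_ne R 1 (by omega) hj hi h
  pt := ⟨fun i R => -(den R.1 k i)⁻¹, fun i _ R => upCoeff_eq R.1 k i, fun i hi m hm R => by
    simp only [den_shift_row R 1 hk hm (show k ≠ k + 1 by omega)]⟩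

theorem rowPair_down (hL : IsGeneric L) {k : ℕ} (hk : k + 1 < n) :
    RowPair (B := tableaux L) (Icc 1 (k + 1)) (Icc 1 k) (fun i R => shift R (k + 1) i (-1))
      (fun i R => shift R k i (-1)) (fun i R => downCoeff R.1 (k + 1) i)
      (fun i R => downCoeff R.1 k i) (fun i R => entry R.1 (k + 1) i)
      (fun i R => entry R.1 k i) (-1) where
  ss i _ j _ R := shift_comm R (k + 1) j (k + 1) i _ _
  tt i _ j _ R := shift_comm R k j k i _ _
  st i _ j _ R := shift_comm R k j (k + 1) i _ _
  as i hi j hj R := by simp [entry_shift R (-1) hk hj]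
  at' i hi j hj R := by simp [entry_shift R (-1) (show k < n by omega) hj]
  bs i hi j hj R := by simp [entry_shift R (-1) hk hj]
  bt i hi j hj R := by simp [entry_shift R (-1) (show k < n by omega) hj]
  ga i hi j hj h R := hL.sub_ne' R hk hi hj h
  gb i hi j hj h R := hL.sub_ne' R (by omega) hi hj h
  qs m hm i hi R := downCoeff_shift_row R (-1) hk hi (by omega) (by omega)
  qt m hm l hl h R := by simpa using hL.downCoeff_shift_ne R (-1) (by omega) hl hm h
  ps i hi j hj h R := by simpa using hL.downCoeff_shift_ne R (-1) hk hj hi h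
  pt := ⟨fun i R => (den R.1 (k + 1) i)⁻¹, fun i _ R => downCoeff_eq R.1 (k + 1) i,
    fun i hi m hm R => by
      simp only [den_shift_row R (-1) (show k < n by omega) hm (show k + 1 ≠ k by omega)]⟩

theorem lie_sum_sum_eq_zero {B : Type*} {I J : Finset ℕ} {s t : ℕ → B → B} {p q : ℕ → B → ℂ}
    (h1 : ∀ i ∈ I, ∀ j ∈ J, ∀ R, s i (t j R) = t j (s i R))
    (h2 : ∀ i ∈ I, ∀ j ∈ J, ∀ R, p i (t j R) * q j R = q j (s i R) * p i R) :
    ⁅∑ i ∈ I, wShift (s i) (p i), ∑ j ∈ J, wShift (t j) (q j)⁆ = 0 := by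
  rw [LieRing.of_associative_ring_bracket, sub_eq_zero, Finset.sum_mul_sum, Finset.sum_mul_sum,
    Finset.sum_comm]
  refine Finset.sum_congr rfl fun j hj => Finset.sum_congr rfl fun i hi => ?_
  refine hom_ext fun R => ?_
  simp [wShift_vec, h1 i hi j hj, h2 i hi j hj]

theorem weight_shift (R : tableaux L) {k i j : ℕ} (e : ℤ) (hk : k < n) (hj : j ∈ Icc 1 k) :
    weight (shift R k j e).1 i = weight R.1 i +
      ((if i = k then (e : ℂ) else 0) - (if i = k + 1 then (e : ℂ) else 0)) := by
  have hk1 : 1 ≤ k := by simp only [mem_Icc] at hj; omega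
  unfold weight
  simp only [entry_shift R e hk hj, Finset.sum_add_distrib]
  have e1 : ∑ x ∈ Icc 1 i, (if i = k ∧ x = j then (e : ℂ) else 0) = if i = k then (e : ℂ) else 0 := by
    by_cases h : i = k
    · subst h; simp only [true_and, Finset.sum_ite_eq', if_pos hj, if_true]
    · simp [h]
  have e2 : ∑ x ∈ Icc 1 (i - 1), (if i - 1 = k ∧ x = j then (e : ℂ) else 0) =
      if i = k + 1 then (e : ℂ) else 0 := by
    by_cases h : i = k + 1
    · subst h
      simp only [Nat.add_sub_cancel, true_and, Finset.sum_ite_eq', if_pos hj, if_true]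
    · have h' : i - 1 ≠ k := by omega
      simp [h, h']
  rw [e1, e2]; ring

theorem lie_wShift_id_sum {B : Type*} {I : Finset ℕ} {s : ℕ → B → B} {p : ℕ → B → ℂ} {w : B → ℂ}
    {c : ℂ} (h : ∀ i ∈ I, ∀ R, w (s i R) = w R + c) :
    ⁅wShift id w, ∑ i ∈ I, wShift (s i) (p i)⁆ = c • ∑ i ∈ I, wShift (s i) (p i) := by
  rw [lie_sum, Finset.smul_sum]
  refine Finset.sum_congr rfl fun i hi => ?_
  rw [LieRing.of_associative_ring_bracket]
  refine hom_ext fun R => ?_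
  simp only [LinearMap.sub_apply,
    Module.End.mul_apply, wShift_vec, LinearMap.smul_apply, h i hi, id, ← vec_sub,
    smul_vec]
  congr 1; ring

theorem lie_opH_opE {k i : ℕ} (hk : k < n) :
    ⁅opH L i, opE L k⁆ = (if i = k then opE L k else 0) - (if i = k + 1 then opE L k else 0) := by
  rw [opH, opE, lie_wShift_id_sum fun j hj R => weight_shift (i := i) R 1 hk hj, sub_smul]
  split_ifs <;> simp

theorem lie_opH_opF {k i : ℕ} (hk : k < n) :
    ⁅opH L i, opF L k⁆ = (if i = k + 1 then opF L k else 0) - (if i = k then opF L k else 0) := by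
  rw [opH, opF, lie_wShift_id_sum fun j hj R => weight_shift (i := i) R (-1) hk hj, sub_smul]
  split_ifs <;> simp

theorem lie_opH_opH (i j : ℕ) : ⁅opH L i, opH L j⁆ = 0 := by
  rw [LieRing.of_associative_ring_bracket, sub_eq_zero]
  refine hom_ext fun R => ?_
  simp [opH, wShift_vec, mul_comm]

theorem lie_opE_opE {k l : ℕ} (hl : l < n) (h : k + 1 < l) : ⁅opE L k, opE L l⁆ = 0 := by
  refine lie_sum_sum_eq_zero (fun i _ j _ R => shift_comm R l j k i 1 1) fun i hi j hj R => ?_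
  rw [upCoeff_shift_row R 1 hl hj (by omega) (by omega),
    upCoeff_shift_row R 1 (by omega) hi (by omega) (by omega), mul_comm]

theorem lie_opF_opF {k l : ℕ} (hl : l < n) (h : k + 1 < l) : ⁅opF L k, opF L l⁆ = 0 := by
  refine lie_sum_sum_eq_zero (fun i _ j _ R => shift_comm R l j k i _ _) fun i hi j hj R => ?_
  rw [downCoeff_shift_row R (-1) hl hj (by omega) (by omega),
    downCoeff_shift_row R (-1) (by omega) hi (by omega) (by omega), mul_comm]

theorem lie_opE_opF_ne {k l : ℕ} (hk : k < n) (hl : l < n) (h : k ≠ l) :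
    ⁅opE L k, opF L l⁆ = 0 := by
  refine lie_sum_sum_eq_zero (fun i _ j _ R => shift_comm R l j k i _ _) fun i hi j hj R => ?_
  have hk1 : 1 ≤ k := by simp only [mem_Icc] at hi; omega
  rcases eq_or_ne l (k + 1) with rfl | h1
  · rw [upCoeff_eq, upCoeff_eq, downCoeff_eq, downCoeff_eq, den_shift_row R _ hl hj h,
      den_shift_row R _ hk hi h.symm, Nat.add_sub_cancel, ← Finset.mul_prod_erase _ _ hj,
      ← Finset.mul_prod_erase _ _ hj, ← Finset.mul_prod_erase _ _ hi,
      ← Finset.mul_prod_erase _ _ hi, entry_shift_self R _ hl hj, entry_shift_self R _ hk hi]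
    simp only [entry_shift_row R _ hl hj h, entry_shift_row R _ hk hi h.symm]
    rw [Finset.prod_congr rfl (fun x hx => by
      rw [entry_shift_ne R (-1) hl hj (ne_of_mem_erase hx)]),
      Finset.prod_congr (s₁ := (Icc 1 k).erase i)
        (f := fun x => _ - entry (shift R k i 1).1 k x) rfl (fun x hx => by
      rw [entry_shift_ne R 1 hk hi (ne_of_mem_erase hx)])]
    push_cast
    ring
  · rw [upCoeff_shift_row R _ hl hj h (Ne.symm h1),
      downCoeff_shift_row R _ hk hi h.symm (by omega), mul_comm]

theorem IsGeneric.lie_opE_opF_self (hL : IsGeneric L) {k : ℕ} (hk1 : 1 ≤ k) (hk : k < n) :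
    ⁅opE L k, opF L k⁆ = opH L k - opH L (k + 1) := by
  have hkm : k ≠ k - 1 := by omega
  have hkp : k + 1 ≠ k := by omega
  have e : ∀ i ∈ Icc 1 k, ∀ j ∈ Icc 1 k,
      ⁅wShift (fun R : tableaux L => shift R k i 1) (fun R => upCoeff R.1 k i),
        wShift (fun R : tableaux L => shift R k j (-1)) (fun R => downCoeff R.1 k j)⁆ =
      if i = j then wShift id (fun R =>
        (∏ m ∈ Icc 1 (k + 1), (entry R.1 k i - entry R.1 (k + 1) m)) *
          (∏ j ∈ Icc 1 (k - 1), (entry R.1 k i + 1 - entry R.1 (k - 1) j)) /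
        ((∏ j ∈ (Icc 1 k).erase i, (entry R.1 k i - entry R.1 k j)) *
          ∏ j ∈ (Icc 1 k).erase i, (entry R.1 k i + 1 - entry R.1 k j)) -
        (∏ m ∈ Icc 1 (k + 1), (entry R.1 k i - 1 - entry R.1 (k + 1) m)) *
          (∏ j ∈ Icc 1 (k - 1), (entry R.1 k i - entry R.1 (k - 1) j)) /
        ((∏ j ∈ (Icc 1 k).erase i, (entry R.1 k i - entry R.1 k j)) *
          ∏ j ∈ (Icc 1 k).erase i, (entry R.1 k i - 1 - entry R.1 k j))) else 0 := by
    intro i hi j hj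
    rw [LieRing.of_associative_ring_bracket]
    refine hom_ext fun R => ?_
    split_ifs with hij
    · subst hij
      simp only [LinearMap.sub_apply,
        Module.End.mul_apply, wShift_vec, id, shift_cancel R k i (show (-1 : ℤ) + 1 = 0 by simp),
        shift_cancel R k i (show (1 : ℤ) + -1 = 0 by simp), ← vec_sub]
      congr 1
      unfold upCoeff downCoeff
      simp only [entry_shift_self R _ hk hi, entry_shift_row R _ hk hi hkm.symm,
        entry_shift_row R _ hk hi hkp]
      rw [Finset.prod_congr (s₁ := (Icc 1 k).erase i) rfl (fun x hx => by
          rw [entry_shift_ne R (-1) hk hi (ne_of_mem_erase hx)]),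
        Finset.prod_congr (s₁ := (Icc 1 k).erase i)
          (f := fun x => _ - entry (shift R k i 1).1 k x) rfl (fun x hx => by
          rw [entry_shift_ne R 1 hk hi (ne_of_mem_erase hx)])]
      push_cast
      simp only [← sub_eq_add_neg, div_eq_mul_inv, mul_inv]
      ring
    · simp only [LinearMap.sub_apply,
        Module.End.mul_apply, wShift_vec, LinearMap.zero_apply]
      rw [shift_comm R k i k j, ← vec_sub]
      refine (congrArg (vec _) ?_).trans (vec_zero _)
      have k1 := hL.upCoeff_shift_ne R (-1) hk hj hi hij
      have k2 := hL.downCoeff_shift_ne R 1 hk hi hj (Ne.symm hij)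
      have g1 := hL.sub_ne R hk hi hj hij (-1)
      have g2 := hL.sub_ne R hk hj hi (Ne.symm hij) 1
      rw [← eq_div_iff g1] at k1
      rw [← eq_div_iff g2] at k2
      rw [k1, k2]
      push_cast at g1 g2 ⊢
      field_simp
      ring
  rw [opE, opF, sum_lie_sum, Finset.sum_congr rfl fun i hi =>
    (Finset.sum_congr rfl (e i hi)).trans ((Finset.sum_ite_eq _ _ _).trans (if_pos hi))]
  refine hom_ext fun R => ?_
  simp only [LinearMap.sub_apply, opH,
    LinearMap.sum_apply, wShift_vec, id, ← vec_sub, ← vec_sum]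
  congr 1
  simp only [mul_one]
  rw [diag_identity (entry R.1 k) (entry R.1 (k + 1)) (entry R.1 (k - 1)) (by simp; omega)
    (by simp only [Nat.card_Icc]; omega) fun i hi j hj h => hL.mem R k i j hk hi hj h]
  unfold weight
  simp only [Nat.card_Icc, Nat.add_sub_cancel]
  push_cast [hk1]
  ring

theorem IsGeneric.chevalleyRel (hL : IsGeneric L) :
    ChevalleyRel n (fun k => opE L (k + 1)) (fun k => opF L (k + 1)) (fun k => opH L (k + 1)) where
  hh i j _ _ := lie_opH_opH _ _
  hx i k _ hk := by simpa using lie_opH_opE (L := L) (i := i + 1) hk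
  hy i k _ hk := by simpa using lie_opH_opF (L := L) (i := i + 1) hk
  xy k l hk hl := by
    split_ifs with h
    · subst h; exact hL.lie_opE_opF_self (by omega) hk
    · exact lie_opE_opF_ne hk hl (by omega)
  xx k l _ hl h := lie_opE_opE hl (by omega)
  yy k l _ hl h := lie_opF_opF hl (by omega)
  sx k hk := (rowPair_up hL (k := k + 1) hk).serre1
  sx' k hk := (rowPair_up hL (k := k + 1) hk).serre2
  sy k hk := (rowPair_down hL (k := k + 1) hk).serre2
  sy' k hk := (rowPair_down hL (k := k + 1) hk).serre1

end

/-! ## The module `V(T(L))` -/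

/-- The Lie algebra `gl(n)` of complex `n × n` matrices; the matrix unit `E_{ij}` (`1 ≤ i, j ≤ n`) is
`Matrix.single (i - 1) (j - 1) 1`. -/
abbrev gl (n : ℕ) : Type := Matrix (Fin n) (Fin n) ℂ

section
variable {n : ℕ} {L : Tableau n}

/-- The space `V(T(L))` with basis `𝓑(T(L))`, for a generic tableau `L`. -/
def GTModule (L : Tableau n) (_hL : IsGeneric L) : Type := FormalSpan (tableaux L)

noncomputable instance (hL : IsGeneric L) : AddCommGroup (GTModule L hL) :=
  inferInstanceAs (AddCommGroup (FormalSpan (tableaux L)))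

noncomputable instance (hL : IsGeneric L) : Module ℂ (GTModule L hL) :=
  inferInstanceAs (Module ℂ (FormalSpan (tableaux L)))

/-- The basis vector of `V(T(L))` given by the tableau `R`. -/
noncomputable def tab (hL : IsGeneric L) (R : tableaux L) : GTModule L hL := vec R 1

/-- The action of `gl(n)` on `V(T(L))`: the generators act by the Gelfand--Tsetlin formulas, and the
other matrix units by the corresponding iterated commutators. -/
noncomputable def action (L : Tableau n) : gl n →ₗ[ℂ] Module.End ℂ (FormalSpan (tableaux L)) :=
  glMap n (fun k => opE L (k + 1)) (fun k => opF L (k + 1)) (fun k => opH L (k + 1))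

theorem action_lie (hL : IsGeneric L) (x y : gl n) :
    action L ⁅x, y⁆ = ⁅action L x, action L y⁆ :=
  glMap_lie hL.chevalleyRel x y

theorem action_leibniz (hL : IsGeneric L) (x y : gl n) (v : FormalSpan (tableaux L)) :
    action L x (action L y v) = action L ⁅x, y⁆ v + action L y (action L x v) := by
  rw [action_lie hL, LieRing.of_associative_ring_bracket, LinearMap.sub_apply,
    Module.End.mul_apply, Module.End.mul_apply, sub_add_cancel]

noncomputable instance (hL : IsGeneric L) : LieRingModule (gl n) (GTModule L hL) where
  bracket x v := action L x v
  add_lie x y v := by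
    change action L (x + y) v = action L x v + action L y v
    rw [map_add]; rfl
  lie_add x v w := map_add (action L x) v w
  leibniz_lie x y v := action_leibniz hL x y v

noncomputable instance (hL : IsGeneric L) : LieModule ℂ (gl n) (GTModule L hL) where
  smul_lie c x v := by
    change action L (c • x) v = c • action L x v
    rw [map_smul]; rfl
  lie_smul c x v := map_smul (action L x) c v

/-- The formula for `E_{k,k+1}` on `V(T(L))`. -/
theorem lie_single_up (hL : IsGeneric L) {k : ℕ} (hk : 1 ≤ k) (hkn : k < n) (R : tableaux L) :
    ⁅(Matrix.single ⟨k - 1, by omega⟩ ⟨k, hkn⟩ 1 : gl n), tab hL R⁆ =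
      -∑ i ∈ Icc 1 k, ((∏ j ∈ Icc 1 (k + 1), (entry R.1 k i - entry R.1 (k + 1) j)) /
        ∏ j ∈ (Icc 1 k).erase i, (entry R.1 k i - entry R.1 k j)) • tab hL (shift R k i 1) := by
  obtain ⟨k, rfl⟩ : ∃ m, k = m + 1 := ⟨k - 1, by omega⟩
  change action L _ (vec R 1) = -∑ i ∈ Icc 1 (k + 1), _ • vec (shift R (k + 1) i 1) (1 : ℂ)
  rw [action, glMap_single, one_smul]
  simp only [Nat.add_sub_cancel, rootVec_self_succ, opE, LinearMap.sum_apply, wShift_vec, smul_vec,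
    ← Finset.sum_neg_distrib, ← vec_neg, upCoeff, mul_one]

/-- The formula for `E_{k+1,k}` on `V(T(L))`. -/
theorem lie_single_down (hL : IsGeneric L) {k : ℕ} (hk : 1 ≤ k) (hkn : k < n) (R : tableaux L) :
    ⁅(Matrix.single ⟨k, hkn⟩ ⟨k - 1, by omega⟩ 1 : gl n), tab hL R⁆ =
      ∑ i ∈ Icc 1 k, ((∏ j ∈ Icc 1 (k - 1), (entry R.1 k i - entry R.1 (k - 1) j)) /
        ∏ j ∈ (Icc 1 k).erase i, (entry R.1 k i - entry R.1 k j)) • tab hL (shift R k i (-1)) := by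
  obtain ⟨k, rfl⟩ : ∃ m, k = m + 1 := ⟨k - 1, by omega⟩
  change action L _ (vec R 1) = ∑ i ∈ Icc 1 (k + 1), _ • vec (shift R (k + 1) i (-1)) (1 : ℂ)
  rw [action, glMap_single, one_smul]
  simp only [Nat.add_sub_cancel, rootVec_succ_self, opF, LinearMap.sum_apply, wShift_vec, smul_vec,
    downCoeff, mul_one]

/-- The formula for `E_{kk}` on `V(T(L))`. -/
theorem lie_single_diag (hL : IsGeneric L) {k : ℕ} (hk : 1 ≤ k) (hkn : k ≤ n) (R : tableaux L) :
    ⁅(Matrix.single ⟨k - 1, by omega⟩ ⟨k - 1, by omega⟩ 1 : gl n), tab hL R⁆ =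
      ((k : ℂ) - 1 + ∑ i ∈ Icc 1 k, entry R.1 k i - ∑ i ∈ Icc 1 (k - 1), entry R.1 (k - 1) i) •
        tab hL R := by
  obtain ⟨k, rfl⟩ : ∃ m, k = m + 1 := ⟨k - 1, by omega⟩
  refine Eq.trans ?_ (smul_vec R _ 1).symm
  change action L _ (vec R 1) = _
  rw [action, glMap_single, one_smul]
  simp only [Nat.add_sub_cancel, rootVec_self, opH, wShift_vec, weight, id]

/-- The set `Ω⁺(T(R))` of triples `(p, s, u)` with `1 < p ≤ n`, `1 ≤ s ≤ p`, `1 ≤ u ≤ p - 1` and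
`r_{p,s} - r_{p-1,u} ∈ ℤ_{≥ 0}`. -/
def OmegaPlus (R : Tableau n) : Set (ℕ × ℕ × ℕ) :=
  {(p, s, u) | 1 < p ∧ p ≤ n ∧ s ∈ Icc 1 p ∧ u ∈ Icc 1 (p - 1) ∧
    ∃ m : ℕ, entry R p s - entry R (p - 1) u = m}

/-- The submodule `U · T(R)` of `V(T(L))` generated by the tableau `R`. -/
noncomputable def cyclicSubmodule (hL : IsGeneric L) (R : tableaux L) :
    LieSubmodule ℂ (gl n) (GTModule L hL) :=
  LieSubmodule.lieSpan ℂ (gl n) {tab hL R}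

/-- The tableaux in the submodule `N` whose set `Ω⁺` is minimal among the tableaux in `N`. -/
def minimalTableaux {hL : IsGeneric L} (N : LieSubmodule ℂ (gl n) (GTModule L hL)) :
    Set (tableaux L) :=
  {R | tab hL R ∈ N ∧ ∀ P : tableaux L, tab hL P ∈ N →
    OmegaPlus P.1 ⊆ OmegaPlus R.1 → OmegaPlus P.1 = OmegaPlus R.1}

/-- `S` is a set of representatives of `Φ` modulo the relation `Ω⁺(T(Q)) = Ω⁺(T(R))`. -/
def IsSetOfRepresentatives (Φ S : Set (tableaux L)) : Prop :=
  S ⊆ Φ ∧ ∀ R ∈ Φ, ∃! Q : tableaux L, Q ∈ S ∧ OmegaPlus Q.1 = OmegaPlus R.1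

end

end GT

namespace GT
open Finset FormalSpan

/-! ## Diagonal operators preserving a subspace -/

section diagonal
variable {B : Type*}

/-! Two facts carry the theorem.

The first is that a submodule is spanned by the tableaux it contains. The separation of tableaux
uses only the generators: by induction on `k`, the projection onto the tableaux with prescribed rows
`1, …, k` preserves every stable subspace (`IsGTStable.indicator_agreeUpTo_mem`). Given these
projections for `k`, compressing `E_{k,k+1}` or `E_{k+1,k}` between two of them isolates one shift
at one position of row `k`. One step up followed by one step down, or the reverse, is then a
diagonal operator. Its eigenvalue contains the polynomial `∏ (y - r_{k+1,j})` evaluated at `y =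
r_{ki}` or `y = r_{ki} - 1`. For each `i` at least one of these two values can be recovered.
Together with the sum of the roots, which comes from `E_{k+1,k+1}`, they determine this monic
polynomial of degree `k + 1`. Its roots, genericity and integrality of differences determine row `k
+ 1` (`IsGeneric.agreeUpTo_succ`). Since the top row is fixed, `k = n - 1` singles out one tableau.

The second is that a submodule containing `T(R)` contains every `T(Q)` with `Ω⁺(R) ⊆ Ω⁺(Q)`. The
isolated shift moves one entry whenever its coefficient is nonzero. The coefficient vanishes exactly
when the move would push the entry past an equal entry of an adjacent row and so remove a triple
from `Ω⁺`. As long as `R ≠ Q`, an extremal choice of the entry to be moved towards `Q` gives a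
nonzero coefficient and keeps `Ω⁺` inside `Ω⁺(Q)` (`exists_raise`, `exists_lower`).

So the tableaux of `N` form an up-set for inclusion of `Ω⁺`. There are finitely many values of `Ω⁺`;
hence every tableau of `N` lies above a minimal one, and one representative for each minimal value
generates. -/

theorem FormalSpan.exists_eq_sum (v : FormalSpan B) :
    ∃ (s : Finset B) (c : B → ℂ), v = ∑ R ∈ s, vec R (c R) :=
  ⟨Finsupp.support v, DFunLike.coe (F := B →₀ ℂ) v, (Finsupp.sum_single (v : B →₀ ℂ)).symm⟩

theorem wShift_id_add (f g : B → ℂ) : wShift id (f + g) = wShift id f + wShift id g := by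
  refine hom_ext fun R => ?_
  simp only [LinearMap.add_apply, wShift_vec, Pi.add_apply, add_mul, vec_add]

theorem wShift_mul (s t : B → B) (p q : B → ℂ) :
    wShift s p * wShift t q = wShift (s ∘ t) fun R => p (t R) * q R := by
  refine hom_ext fun R => ?_
  simp only [Module.End.mul_apply, wShift_vec, Function.comp, mul_assoc]

theorem wShift_id_const (c : ℂ) : wShift id (fun _ : B => c) = c • 1 := by
  refine hom_ext fun R => ?_
  simp only [LinearMap.smul_apply, wShift_vec, id, Module.End.one_apply, smul_vec]

/-- The functions on the basis whose diagonal operators preserve the subspace `W`. -/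
def diagStabilizer (W : Submodule ℂ (FormalSpan B)) : Subalgebra ℂ (B → ℂ) where
  carrier := {f | ∀ v ∈ W, wShift id f v ∈ W}
  mul_mem' {f g} hf hg v hv := by
    have : wShift id (f * g) = wShift id f * wShift id g := by rw [wShift_mul]; rfl
    rw [this]; exact hf _ (hg _ hv)
  add_mem' {f g} hf hg v hv := by
    rw [wShift_id_add]; exact W.add_mem (hf v hv) (hg v hv)
  algebraMap_mem' c v hv := by
    have : wShift id (algebraMap ℂ (B → ℂ) c) = c • 1 := wShift_id_const c
    rw [this]; exact W.smul_mem c hv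

theorem mem_diagStabilizer {W : Submodule ℂ (FormalSpan B)} {f : B → ℂ} :
    f ∈ diagStabilizer W ↔ ∀ v ∈ W, wShift id f v ∈ W := Iff.rfl

/-- If every point outside `C` is separated from a point of `C` by a function in the stabilizer
which is constant on `C`, then the projection to `C` preserves the subspace. -/
theorem indicator_mem_diagStabilizer {W : Submodule ℂ (FormalSpan B)} {C : Set B} {R₀ : B}
    (h : ∀ R ∉ C, ∃ f ∈ diagStabilizer W, f R ≠ f R₀ ∧ ∀ R' ∈ C, f R' = f R₀) :
    C.indicator 1 ∈ diagStabilizer W := by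
  classical
  intro v hv
  obtain ⟨s, c, rfl⟩ := exists_eq_sum v
  -- Lagrange interpolation: an affine function of the separating `f` is `1` on `C` and `0` at the
  -- given point. The product over the finite support of `v` then acts on `v` as the indicator of
  -- `C`, although the two functions may differ elsewhere.
  have hg : ∀ R, ∃ g ∈ diagStabilizer W, (∀ R' ∈ C, g R' = 1) ∧ (R ∉ C → g R = 0) := by
    intro R
    by_cases hR : R ∈ C
    · exact ⟨1, one_mem _, fun _ _ => rfl, fun h => absurd hR h⟩
    · obtain ⟨f, hf, hne, hC⟩ := h R hR
      refine ⟨(f R₀ - f R)⁻¹ • (f - algebraMap ℂ (B → ℂ) (f R)),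
        Subalgebra.smul_mem _ (sub_mem hf (Subalgebra.algebraMap_mem _ _)) _,
        fun R' hR' => ?_, fun _ => ?_⟩
      · have : f R₀ - f R ≠ 0 := sub_ne_zero.2 hne.symm
        simp [hC R' hR', this]
      · simp
  choose g hgW hg1 hg0 using hg
  have hprod := prod_mem (S := diagStabilizer W) (t := s) (f := g) fun R _ => hgW R
  have key : wShift id (C.indicator 1) (∑ R ∈ s, vec R (c R)) =
      wShift id (∏ R ∈ s, g R) (∑ R ∈ s, vec R (c R)) := by
    rw [map_sum, map_sum]
    refine Finset.sum_congr rfl fun R hR => ?_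
    rw [wShift_vec, wShift_vec, Finset.prod_apply]
    congr 2
    by_cases hC : R ∈ C
    · rw [Set.indicator_of_mem hC, Finset.prod_eq_one fun R' _ => hg1 R' R hC]; rfl
    · rw [Set.indicator_of_notMem hC, Finset.prod_eq_zero (f := fun j => g j R) hR (hg0 R hC)]
  rw [key]
  exact hprod _ hv

theorem indicator_singleton_apply_sum (s : Finset B) (c : B → ℂ) {R : B} (hR : R ∈ s) :
    wShift id (Set.indicator {R} 1) (∑ P ∈ s, vec P (c P)) = vec R (c R) := by
  rw [map_sum, Finset.sum_eq_single R]
  · rw [wShift_vec, Set.indicator_of_mem (Set.mem_singleton R), Pi.one_apply, one_mul, id]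
  · intro P _ hP
    rw [wShift_vec, Set.indicator_of_notMem (by simpa using hP), zero_mul, vec_zero]
  · exact fun h => absurd hR h

/-- Compressing a sum of weighted shifts between two sets which only one of the shifts connects. -/
theorem indicator_mul_sum_mul_indicator {ι : Type*} (I : Finset ι) (s : ι → B → B)
    (p : ι → B → ℂ) {i : ι} (hi : i ∈ I) (C C' : Set B)
    (h : ∀ R ∈ C, ∀ j ∈ I, s j R ∈ C' ↔ j = i) :
    wShift id (C'.indicator 1) * (∑ j ∈ I, wShift (s j) (p j)) * wShift id (C.indicator 1) =
      wShift (s i) (C.indicator (p i)) := by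
  refine hom_ext fun R => ?_
  simp only [Module.End.mul_apply, wShift_vec, LinearMap.sum_apply, map_sum, id]
  by_cases hR : R ∈ C
  · rw [Finset.sum_eq_single i]
    · simp [(h R hR i hi).2 rfl, hR]
    · intro j hj hji
      rw [Set.indicator_of_notMem (fun hh => hji ((h R hR j hj).1 hh)), zero_mul, vec_zero]
    · exact fun h => absurd hi h
  · rw [Set.indicator_of_notMem hR, Set.indicator_of_notMem hR]
    simp [vec_zero]

end diagonal

/-! ## Separation of tableaux by diagonal operators -/

/-- Two monic polynomials of degree `k + 1` with equal sums of roots differ by a polynomial of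
degree less than `k`, which vanishes as soon as it has `k` distinct zeros. -/
theorem prod_sub_eq_of_eval_eq {k : ℕ} {x a b : ℕ → ℂ} (hx : Set.InjOn x (Icc 1 k))
    (hsum : ∑ j ∈ Icc 1 (k + 1), a j = ∑ j ∈ Icc 1 (k + 1), b j)
    (h : ∀ i ∈ Icc 1 k, ∏ j ∈ Icc 1 (k + 1), (x i - a j) = ∏ j ∈ Icc 1 (k + 1), (x i - b j))
    (y : ℂ) : ∏ j ∈ Icc 1 (k + 1), (y - a j) = ∏ j ∈ Icc 1 (k + 1), (y - b j) := by
  have hev : ∀ (c : ℕ → ℂ) z, (∏ j ∈ Icc 1 (k + 1), (Polynomial.X - Polynomial.C (c j))).eval z =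
      ∏ j ∈ Icc 1 (k + 1), (z - c j) := fun c z => by simp [Polynomial.eval_prod]
  have hdeg : ∀ c : ℕ → ℂ,
      (∏ j ∈ Icc 1 (k + 1), (Polynomial.X - Polynomial.C (c j))).natDegree = k + 1 := fun c => by
    simp [Polynomial.natDegree_finsetProd_X_sub_C_eq_card]
  have hmon : ∀ c : ℕ → ℂ,
      (∏ j ∈ Icc 1 (k + 1), (Polynomial.X - Polynomial.C (c j))).Monic := fun c =>
    Polynomial.monic_prod_X_sub_C c _
  have hnext : ∀ c : ℕ → ℂ,
      (∏ j ∈ Icc 1 (k + 1), (Polynomial.X - Polynomial.C (c j))).coeff k =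
        -∑ j ∈ Icc 1 (k + 1), c j := fun c => by
    simpa using Polynomial.prod_X_sub_C_coeff_card_pred (Icc 1 (k + 1)) c (by simp)
  have heq := Polynomial.eq_of_degree_sub_lt_of_eval_index_eq
    (f := ∏ j ∈ Icc 1 (k + 1), (Polynomial.X - Polynomial.C (a j)))
    (g := ∏ j ∈ Icc 1 (k + 1), (Polynomial.X - Polynomial.C (b j))) (Icc 1 k) hx ?_ ?_
  · rw [← hev, ← hev, heq]
  · rw [Polynomial.degree_lt_iff_coeff_zero]
    intro m hm
    rw [Nat.card_Icc, Nat.add_sub_cancel] at hm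
    rw [Polynomial.coeff_sub]
    obtain rfl | rfl | hm : m = k ∨ m = k + 1 ∨ k + 1 < m := by omega
    · rw [hnext, hnext, hsum, sub_self]
    · have h1 := (hmon a).coeff_natDegree
      have h2 := (hmon b).coeff_natDegree
      rw [hdeg] at h1 h2
      rw [h1, h2, sub_self]
    · rw [Polynomial.coeff_eq_zero_of_natDegree_lt (by rwa [hdeg]),
        Polynomial.coeff_eq_zero_of_natDegree_lt (by rwa [hdeg]), sub_self]
  · intro i hi
    rw [hev, hev, h i hi]

section
variable {n : ℕ} {L : Tableau n}

theorem entry_sub_entry_int (R Q : tableaux L) (k i : ℕ) :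
    ∃ m : ℤ, entry R.1 k i - entry Q.1 k i = m := by
  obtain ⟨z, -, hz⟩ := R.2
  obtain ⟨w, -, hw⟩ := Q.2
  unfold entry
  split_ifs with h
  · exact ⟨z ⟨(k, i), h⟩ - w ⟨(k, i), h⟩, by rw [hz, hw]; push_cast; ring⟩
  · exact ⟨0, by simp⟩

theorem entry_top (R Q : tableaux L) (i : ℕ) : entry R.1 n i = entry Q.1 n i := by
  obtain ⟨z, hz0, hz⟩ := R.2
  obtain ⟨w, hw0, hw⟩ := Q.2
  unfold entry
  split_ifs with h
  · rw [hz, hw, hz0 _ rfl, hw0 _ rfl]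
  · rfl

theorem tableaux_ext {R Q : tableaux L}
    (h : ∀ k < n, ∀ i ∈ Icc 1 k, entry R.1 k i = entry Q.1 k i) : R = Q := by
  apply Subtype.ext
  funext ⟨⟨k, i⟩, hp⟩
  have key : entry R.1 k i = entry Q.1 k i := by
    obtain hk | rfl := lt_or_eq_of_le hp.2.2
    · exact h k hk i (mem_Icc.2 ⟨hp.1, hp.2.1⟩)
    · exact entry_top R Q i
  unfold entry at key
  rwa [dif_pos hp, dif_pos hp] at key

/-- The tableaux with the same rows `1, …, k` as `R₀`. -/
def agreeUpTo (k : ℕ) (R₀ : tableaux L) : Set (tableaux L) :=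
  {R | ∀ m ≤ k, ∀ j, entry R.1 m j = entry R₀.1 m j}

/-- Different positions of row `k` lead to different classes of rows `1, …, k`. This is the
hypothesis of `indicator_mul_sum_mul_indicator`, so projections can pick out one term of a
Gelfand--Tsetlin formula. -/
theorem shift_mem_agreeUpTo {k i j : ℕ} {e : ℤ} (he : e ≠ 0) {R R₀ : tableaux L} (hk : k < n)
    (hi : i ∈ Icc 1 k) (hj : j ∈ Icc 1 k) (hR : R ∈ agreeUpTo k R₀) :
    shift R k j e ∈ agreeUpTo k (shift R₀ k i e) ↔ j = i := by
  constructor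
  · intro h
    by_contra hne
    have := h k le_rfl j
    rw [entry_shift_self R e hk hj, entry_shift_ne R₀ e hk hi hne, hR k le_rfl j] at this
    simp [he] at this
  · rintro rfl m hm l
    rw [entry_shift R e hk hi, entry_shift R₀ e hk hi, hR m hm l]

theorem den_congr {R Q : tableaux L} {k : ℕ} (h : Q ∈ agreeUpTo k R) (i : ℕ) :
    den Q.1 k i = den R.1 k i := by
  unfold den; simp only [h k le_rfl]

/-- The raising coefficient sees row `k + 1`, whereas the lowering coefficient sees only rows `k`
and `k - 1`. Once rows up to `k` are fixed, only the raising factor carries new information. -/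
theorem upCoeff_congr {R Q : tableaux L} {k : ℕ} (h : Q ∈ agreeUpTo (k + 1) R) (i : ℕ) :
    upCoeff Q.1 k i = upCoeff R.1 k i := by
  unfold upCoeff; simp only [h k (Nat.le_succ k), h (k + 1) le_rfl]

theorem downCoeff_congr {R Q : tableaux L} {k : ℕ} (h : Q ∈ agreeUpTo k R) (i : ℕ) :
    downCoeff Q.1 k i = downCoeff R.1 k i := by
  unfold downCoeff; simp only [h k le_rfl, h (k - 1) (Nat.sub_le k 1)]

theorem shift_mem_agreeUpTo_shift {R Q : tableaux L} {k m i : ℕ} {e : ℤ} (hk : k < n)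
    (hi : i ∈ Icc 1 k) (h : Q ∈ agreeUpTo m R) : shift Q k i e ∈ agreeUpTo m (shift R k i e) := by
  intro l hl j
  rw [entry_shift Q e hk hi, entry_shift R e hk hi, h l hl]

/-- The zero set of the coefficient `downCoeff`. -/
theorem IsGeneric.downCoeff_eq_zero_iff (hL : IsGeneric L) (R : tableaux L) {k i : ℕ} (hk : k < n)
    (hi : i ∈ Icc 1 k) :
    downCoeff R.1 k i = 0 ↔ ∃ j ∈ Icc 1 (k - 1), entry R.1 k i = entry R.1 (k - 1) j := by
  rw [downCoeff_eq, mul_eq_zero, or_iff_right (inv_ne_zero (hL.den_ne R hk hi)),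
    Finset.prod_eq_zero_iff]
  simp only [sub_eq_zero]

theorem IsGeneric.upCoeff_eq_zero_iff (hL : IsGeneric L) (R : tableaux L) {k i : ℕ} (hk : k < n)
    (hi : i ∈ Icc 1 k) :
    upCoeff R.1 k i = 0 ↔ ∃ j ∈ Icc 1 (k + 1), entry R.1 k i = entry R.1 (k + 1) j := by
  rw [upCoeff_eq, mul_eq_zero, or_iff_right (neg_ne_zero.2 (inv_ne_zero (hL.den_ne R hk hi))),
    Finset.prod_eq_zero_iff]
  simp only [sub_eq_zero]

theorem IsGeneric.prod_eq_of_upCoeff_eq (hL : IsGeneric L) {R Q : tableaux L} {k i : ℕ}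
    (hk : k < n) (hi : i ∈ Icc 1 k) (h : Q ∈ agreeUpTo k R)
    (hu : upCoeff Q.1 k i = upCoeff R.1 k i) :
    ∏ j ∈ Icc 1 (k + 1), (entry R.1 k i - entry Q.1 (k + 1) j) =
      ∏ j ∈ Icc 1 (k + 1), (entry R.1 k i - entry R.1 (k + 1) j) := by
  rw [upCoeff_eq, upCoeff_eq, den_congr h] at hu
  simp only [h k le_rfl] at hu
  exact mul_left_cancel₀ (neg_ne_zero.2 (inv_ne_zero (hL.den_ne R hk hi))) hu

/-- Row `k + 1` is determined by the rows `1, …, k`, the weight, and the eigenvalues of the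
compressions of `E_{k+1,k} E_{k,k+1}` and `E_{k,k+1} E_{k+1,k}`. -/
theorem IsGeneric.agreeUpTo_succ (hL : IsGeneric L) {R Q : tableaux L} {k : ℕ} (hk : k + 1 < n)
    (h : Q ∈ agreeUpTo k R) (hw : weight Q.1 (k + 1) = weight R.1 (k + 1))
    (hdu : ∀ i ∈ Icc 1 k, downCoeff (shift Q k i 1).1 k i * upCoeff Q.1 k i =
      downCoeff (shift R k i 1).1 k i * upCoeff R.1 k i)
    (hud : ∀ i ∈ Icc 1 k, upCoeff (shift Q k i (-1)).1 k i * downCoeff Q.1 k i =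
      upCoeff (shift R k i (-1)).1 k i * downCoeff R.1 k i) : Q ∈ agreeUpTo (k + 1) R := by
  have hkn : k < n := by omega
  -- The node attached to `i` is `r_{ki}` or `r_{ki} - 1`, depending on which of the two eigenvalues
  -- has a nonzero lowering factor that can be cancelled.
  have hx : ∀ i ∈ Icc 1 k, ∃ m : ℤ,
      ∏ j ∈ Icc 1 (k + 1), (entry R.1 k i + m - entry Q.1 (k + 1) j) =
      ∏ j ∈ Icc 1 (k + 1), (entry R.1 k i + m - entry R.1 (k + 1) j) := by
    intro i hi
    have hi' := mem_Icc.1 hi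
    by_cases hd : downCoeff R.1 k i = 0
    -- The two lowering factors cannot both vanish: `r_{ki}` and `r_{ki} + 1` would both be entries
    -- of row `k - 1`, which is generic.
    · have hd' : downCoeff (shift R k i 1).1 k i ≠ 0 := by
        rw [Ne, hL.downCoeff_eq_zero_iff _ hkn hi]
        rintro ⟨j', hj', h'⟩
        obtain ⟨j, hj, hh⟩ := (hL.downCoeff_eq_zero_iff _ hkn hi).1 hd
        rw [entry_shift_self R 1 hkn hi, entry_shift_row R 1 hkn hi (by omega)] at h'
        have hne : j' ≠ j := by
          rintro rfl
          rw [← hh] at h'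
          simp at h'
        refine hL.sub_ne R (k := k - 1) (by omega) hj' hj hne 1 ?_
        rw [← h', ← hh]; ring
      refine ⟨0, ?_⟩
      have hu := hdu i hi
      rw [downCoeff_congr (shift_mem_agreeUpTo_shift hkn hi h)] at hu
      simpa using hL.prod_eq_of_upCoeff_eq hkn hi h (mul_left_cancel₀ hd' hu)
    · refine ⟨-1, ?_⟩
      have hu := hud i hi
      rw [downCoeff_congr h] at hu
      have := hL.prod_eq_of_upCoeff_eq hkn hi (shift_mem_agreeUpTo_shift hkn hi h)
        (mul_right_cancel₀ hd hu)
      rw [entry_shift_self R _ hkn hi] at this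
      simpa only [entry_shift_row _ (-1) hkn hi (Nat.succ_ne_self k)] using this
  choose! m hm using hx
  -- Integer displacements cannot make the nodes collide, since row `k` is generic.
  have hinj : Set.InjOn (fun i => entry R.1 k i + m i) (Icc 1 k) := by
    intro i hi j hj hij
    by_contra hne
    refine hL.sub_ne R hkn hi hj hne (m j - m i) ?_
    push_cast
    linear_combination hij
  have hs : ∑ j ∈ Icc 1 (k + 1), entry Q.1 (k + 1) j = ∑ j ∈ Icc 1 (k + 1), entry R.1 (k + 1) j := by
    unfold weight at hw
    simp only [Nat.add_sub_cancel, h k le_rfl] at hw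
    linear_combination hw
  have key := prod_sub_eq_of_eval_eq hinj hs hm
  intro l hl j
  obtain hl | rfl := Nat.le_or_eq_of_le_succ hl
  · exact h l hl j
  by_cases hj : j ∈ Icc 1 (k + 1)
  -- Each entry of row `k + 1` of `R` is a root, hence equals some entry of row `k + 1` of `Q`. The
  -- column must be the same: entries of `Q` and `R` in one column differ by an integer, entries of
  -- `R` in different columns do not.
  · have h0 := key (entry R.1 (k + 1) j)
    rw [Finset.prod_eq_zero (i := j) (s := Icc 1 (k + 1))
      (f := fun j' => entry R.1 (k + 1) j - entry R.1 (k + 1) j') hj (sub_self _),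
      Finset.prod_eq_zero_iff] at h0
    obtain ⟨j', hj', h0⟩ := h0
    rw [sub_eq_zero] at h0
    obtain rfl | hne := eq_or_ne j' j
    · exact h0.symm
    · obtain ⟨c, hc⟩ := entry_sub_entry_int R Q (k + 1) j'
      refine absurd ?_ (hL.sub_ne R hk hj' hj hne c)
      rw [← hc, h0]; ring
  · have : ¬ (1 ≤ j ∧ j ≤ k + 1 ∧ k + 1 ≤ n) := fun hh => hj (mem_Icc.2 ⟨hh.1, hh.2.1⟩)
    unfold entry
    rw [dif_neg this, dif_neg this]

end

/-! ## Submodules are spanned by tableaux -/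

section
variable {n : ℕ} {L : Tableau n}

/-- Stability of a subspace under the Gelfand--Tsetlin operators. -/
structure IsGTStable (W : Submodule ℂ (FormalSpan (tableaux L))) : Prop where
  opE_mem : ∀ k, 1 ≤ k → k < n → ∀ v ∈ W, opE L k v ∈ W
  opF_mem : ∀ k, 1 ≤ k → k < n → ∀ v ∈ W, opF L k v ∈ W
  opH_mem : ∀ k, 1 ≤ k → k ≤ n → ∀ v ∈ W, opH L k v ∈ W

variable {W : Submodule ℂ (FormalSpan (tableaux L))} {k i : ℕ}

theorem self_mem_agreeUpTo (k : ℕ) (R : tableaux L) : R ∈ agreeUpTo k R := fun _ _ _ => rfl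

/-- The operator is `E_{k,k+1}` compressed between the projections for `R` and for its shift at `(k,
i)`. The projections are kept as a hypothesis because the induction that constructs them uses this
lemma. -/
theorem IsGTStable.up_mem (hW : IsGTStable W) (hk : k < n) (hi : i ∈ Icc 1 k)
    (hP : ∀ R : tableaux L, (agreeUpTo k R).indicator 1 ∈ diagStabilizer W) (R : tableaux L)
    {v : FormalSpan (tableaux L)} (hv : v ∈ W) :
    wShift (fun R => shift R k i 1) ((agreeUpTo k R).indicator fun R => upCoeff R.1 k i) v ∈ W := by
  rw [← indicator_mul_sum_mul_indicator (Icc 1 k) (fun i R => shift R k i 1)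
    (fun i R => upCoeff R.1 k i) hi _ (agreeUpTo k (shift R k i 1))
    fun Q hQ j hj => shift_mem_agreeUpTo one_ne_zero hk hi hj hQ]
  exact hP _ _ (hW.opE_mem k (by simp only [mem_Icc] at hi; omega) hk _ (hP _ _ hv))

theorem IsGTStable.down_mem (hW : IsGTStable W) (hk : k < n) (hi : i ∈ Icc 1 k)
    (hP : ∀ R : tableaux L, (agreeUpTo k R).indicator 1 ∈ diagStabilizer W) (R : tableaux L)
    {v : FormalSpan (tableaux L)} (hv : v ∈ W) :
    wShift (fun R => shift R k i (-1)) ((agreeUpTo k R).indicator fun R => downCoeff R.1 k i) v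
      ∈ W := by
  rw [← indicator_mul_sum_mul_indicator (Icc 1 k) (fun i R => shift R k i (-1))
    (fun i R => downCoeff R.1 k i) hi _ (agreeUpTo k (shift R k i (-1)))
    fun Q hQ j hj => shift_mem_agreeUpTo (by decide) hk hi hj hQ]
  exact hP _ _ (hW.opF_mem k (by simp only [mem_Icc] at hi; omega) hk _ (hP _ _ hv))

/-- A compressed step followed by the opposite one returns to the starting tableau. This is the
source of new diagonal operators in the induction. -/
theorem wShift_mul_indicator_cancel {e f : ℤ} (hef : e + f = 0) (hk : k < n) (hi : i ∈ Icc 1 k)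
    (R : tableaux L) (p q : tableaux L → ℂ) :
    wShift (fun R => shift R k i f) ((agreeUpTo k (shift R k i e)).indicator q) *
      wShift (fun R => shift R k i e) ((agreeUpTo k R).indicator p) =
      wShift id ((agreeUpTo k R).indicator fun Q => q (shift Q k i e) * p Q) := by
  rw [wShift_mul]
  congr 1
  · funext Q; exact shift_cancel Q k i hef
  · funext Q
    by_cases hQ : Q ∈ agreeUpTo k R
    · rw [Set.indicator_of_mem hQ, Set.indicator_of_mem hQ,
        Set.indicator_of_mem (shift_mem_agreeUpTo_shift hk hi hQ)]
    · rw [Set.indicator_of_notMem hQ, Set.indicator_of_notMem hQ, mul_zero]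

/-- The projections to the tableaux with given rows `1, …, k` preserve every stable subspace. -/
theorem IsGTStable.indicator_agreeUpTo_mem (hL : IsGeneric L) (hW : IsGTStable W) (hk : k < n)
    (R : tableaux L) : (agreeUpTo k R).indicator 1 ∈ diagStabilizer W := by
  induction k generalizing R with
  | zero =>
    -- Row `0` has only the default entries `0`, so the class is everything and no separation is
    -- needed.
    refine indicator_mem_diagStabilizer (R₀ := R) fun Q hQ => absurd ?_ hQ
    intro m hm j
    have : ¬ (1 ≤ j ∧ j ≤ m ∧ m ≤ n) := by omega
    unfold entry
    rw [dif_neg this, dif_neg this]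
  | succ k ih =>
    have hkn : k < n := by omega
    have ih := fun R => ih hkn R
    have hself : R ∈ agreeUpTo k R := self_mem_agreeUpTo k R
    have hsub : ∀ Q ∈ agreeUpTo (k + 1) R, Q ∈ agreeUpTo k R := fun Q hQ m hm =>
      hQ m (by omega)
    refine indicator_mem_diagStabilizer (R₀ := R) fun Q hQ => ?_
    by_cases hQk : Q ∈ agreeUpTo k R
    swap
    · refine ⟨_, ih R, ?_, fun Q' hQ' => ?_⟩
      · rw [Set.indicator_of_notMem hQk, Set.indicator_of_mem hself]
        exact zero_ne_one
      · rw [Set.indicator_of_mem (hsub Q' hQ'), Set.indicator_of_mem hself]; rfl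
    -- If no stabilizing function constant on the class separated `Q` from `R`, then the weight and
    -- all the two-step eigenvalues would agree on them, and row `k + 1` would coincide.
    by_contra! hcon
    refine hQ (hL.agreeUpTo_succ hk hQk ?_ ?_ ?_)
    · by_contra hne
      obtain ⟨Q', hQ', h⟩ := hcon (fun R => weight R.1 (k + 1))
        (hW.opH_mem (k + 1) (by omega) hk.le) hne
      refine h ?_
      simp only [weight, Nat.add_sub_cancel, hQ' (k + 1) le_rfl, hQ' k (Nat.le_succ k)]
    · intro i hi
      by_contra hne
      obtain ⟨Q', hQ', h⟩ := hcon ((agreeUpTo k R).indicator fun Q =>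
        downCoeff (shift Q k i 1).1 k i * upCoeff Q.1 k i)
        (fun v hv => by
          rw [← wShift_mul_indicator_cancel (show (1 : ℤ) + -1 = 0 by simp) hkn hi R
            (fun Q => upCoeff Q.1 k i) (fun Q => downCoeff Q.1 k i)]
          exact hW.down_mem hkn hi ih _ (hW.up_mem hkn hi ih _ hv))
        (by rwa [Set.indicator_of_mem hQk, Set.indicator_of_mem hself])
      refine h ?_
      rw [Set.indicator_of_mem (hsub Q' hQ'), Set.indicator_of_mem hself, upCoeff_congr hQ',
        downCoeff_congr (shift_mem_agreeUpTo_shift hkn hi (hsub Q' hQ'))]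
    · intro i hi
      by_contra hne
      obtain ⟨Q', hQ', h⟩ := hcon ((agreeUpTo k R).indicator fun Q =>
        upCoeff (shift Q k i (-1)).1 k i * downCoeff Q.1 k i)
        (fun v hv => by
          rw [← wShift_mul_indicator_cancel (show (-1 : ℤ) + 1 = 0 by simp) hkn hi R
            (fun Q => downCoeff Q.1 k i) (fun Q => upCoeff Q.1 k i)]
          exact hW.up_mem hkn hi ih _ (hW.down_mem hkn hi ih _ hv))
        (by rwa [Set.indicator_of_mem hQk, Set.indicator_of_mem hself])
      refine h ?_
      rw [Set.indicator_of_mem (hsub Q' hQ'), Set.indicator_of_mem hself,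
        downCoeff_congr (hsub Q' hQ'), upCoeff_congr (shift_mem_agreeUpTo_shift hkn hi hQ')]

theorem vec_one_mem_of_vec_mem {B : Type*} {W : Submodule ℂ (FormalSpan B)} {R : B} {c : ℂ}
    (hc : c ≠ 0) (h : vec R c ∈ W) : vec R 1 ∈ W := by
  have := W.smul_mem c⁻¹ h
  rwa [smul_vec, inv_mul_cancel₀ hc] at this

/-- The compressed raising operator sends a tableau to a multiple of a single neighbour. -/
theorem IsGTStable.vec_shift_up_mem (hL : IsGeneric L) (hW : IsGTStable W) (hk : k < n)
    (hi : i ∈ Icc 1 k) {R : tableaux L} (hR : vec R 1 ∈ W) (hc : upCoeff R.1 k i ≠ 0) :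
    vec (shift R k i 1) 1 ∈ W := by
  have h := hW.up_mem hk hi (fun R => hW.indicator_agreeUpTo_mem hL hk R) R hR
  rw [wShift_vec, Set.indicator_of_mem (self_mem_agreeUpTo k R), mul_one] at h
  exact vec_one_mem_of_vec_mem hc h

theorem IsGTStable.vec_shift_down_mem (hL : IsGeneric L) (hW : IsGTStable W) (hk : k < n)
    (hi : i ∈ Icc 1 k) {R : tableaux L} (hR : vec R 1 ∈ W) (hc : downCoeff R.1 k i ≠ 0) :
    vec (shift R k i (-1)) 1 ∈ W := by
  have h := hW.down_mem hk hi (fun R => hW.indicator_agreeUpTo_mem hL hk R) R hR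
  rw [wShift_vec, Set.indicator_of_mem (self_mem_agreeUpTo k R), mul_one] at h
  exact vec_one_mem_of_vec_mem hc h

/-- A stable subspace is contained in every subspace that contains the same tableaux. -/
theorem IsGTStable.le_of_vec_mem (hn : 0 < n) (hL : IsGeneric L) (hW : IsGTStable W)
    {W' : Submodule ℂ (FormalSpan (tableaux L))} (h : ∀ R, vec R 1 ∈ W → vec R 1 ∈ W') :
    W ≤ W' := by
  intro v hv
  obtain ⟨s, c, rfl⟩ := exists_eq_sum v
  refine W'.sum_mem fun R hR => ?_
  -- The top row is common to all tableaux, so rows below it determine the tableau; the projection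
  -- now extracts a single term of `v`.
  have hset : agreeUpTo (n - 1) R = {R} := by
    ext Q
    refine ⟨fun hQ => tableaux_ext fun k hk i _ => hQ k (by omega) i, ?_⟩
    rintro rfl _ _ _
    rfl
  have hmem := hW.indicator_agreeUpTo_mem hL (show n - 1 < n by omega) R _ hv
  rw [hset, indicator_singleton_apply_sum s c hR] at hmem
  by_cases hc : c R = 0
  · rw [hc, vec_zero]; exact W'.zero_mem
  · have := W'.smul_mem (c R) (h R (vec_one_mem_of_vec_mem hc hmem))
    rwa [smul_vec, mul_one] at this

theorem isGTStable_toSubmodule {hL : IsGeneric L} (N : LieSubmodule ℂ (gl n) (GTModule L hL)) :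
    IsGTStable (L := L) (N : Submodule ℂ (GTModule L hL)) where
  opE_mem k hk hkn v hv := by
    obtain ⟨k, rfl⟩ : ∃ m, k = m + 1 := ⟨k - 1, by omega⟩
    have h : action L (Matrix.single ⟨k, by omega⟩ ⟨k + 1, hkn⟩ 1) v ∈ N := N.lie_mem hv
    rwa [action, glMap_single, one_smul, rootVec_self_succ] at h
  opF_mem k hk hkn v hv := by
    obtain ⟨k, rfl⟩ : ∃ m, k = m + 1 := ⟨k - 1, by omega⟩
    have h : action L (Matrix.single ⟨k + 1, hkn⟩ ⟨k, by omega⟩ 1) v ∈ N := N.lie_mem hv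
    rwa [action, glMap_single, one_smul, rootVec_succ_self] at h
  opH_mem k hk hkn v hv := by
    obtain ⟨k, rfl⟩ : ∃ m, k = m + 1 := ⟨k - 1, by omega⟩
    have h : action L (Matrix.single ⟨k, by omega⟩ ⟨k, by omega⟩ 1) v ∈ N := N.lie_mem hv
    rwa [action, glMap_single, one_smul, rootVec_self] at h

end

/-! ## Paths between tableaux -/

section
variable {n : ℕ} {L : Tableau n}

/-- The integer difference of the entries of `Q` and `R` at position `(k, i)`. -/
noncomputable def gap (R Q : tableaux L) (k i : ℕ) : ℤ := ⌊(entry Q.1 k i - entry R.1 k i).re⌋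

/-- The difference of the entries is already an integer, so taking the floor of its real part loses
nothing. -/
theorem entry_eq_add_gap (R Q : tableaux L) (k i : ℕ) :
    entry Q.1 k i = entry R.1 k i + gap R Q k i := by
  obtain ⟨m, hm⟩ := entry_sub_entry_int Q R k i
  rw [gap, hm, Complex.intCast_re, Int.floor_intCast, ← hm]
  ring

theorem gap_eq_of_entry_eq {R Q : tableaux L} {k i : ℕ} {m : ℤ}
    (h : entry Q.1 k i = entry R.1 k i + m) : gap R Q k i = m := by
  rw [gap, h, add_sub_cancel_left, Complex.intCast_re, Int.floor_intCast]

theorem gap_top (R Q : tableaux L) (i : ℕ) : gap R Q n i = 0 :=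
  gap_eq_of_entry_eq (by rw [entry_top R Q, Int.cast_zero, add_zero])

theorem gap_shift (R Q : tableaux L) {k i : ℕ} (e : ℤ) (hk : k < n) (hi : i ∈ Icc 1 k) (l j : ℕ) :
    gap (shift R k i e) Q l j = gap R Q l j - if l = k ∧ j = i then e else 0 := by
  apply gap_eq_of_entry_eq
  rw [entry_shift R e hk hi, entry_eq_add_gap R Q]
  push_cast
  ring

theorem mem_OmegaPlus_iff {R : Tableau n} {k s u : ℕ} (hk : 1 ≤ k) (hkn : k < n)
    (hs : s ∈ Icc 1 (k + 1)) (hu : u ∈ Icc 1 k) :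
    (k + 1, s, u) ∈ OmegaPlus R ↔ ∃ m : ℤ, 0 ≤ m ∧ entry R (k + 1) s = entry R k u + m := by
  constructor
  · rintro ⟨-, -, -, -, m, hm⟩
    rw [Nat.add_sub_cancel] at hm
    exact ⟨m, by positivity, by rw [Int.cast_natCast, ← hm]; ring⟩
  · rintro ⟨m, hm, h⟩
    lift m to ℕ using hm
    exact ⟨by omega, hkn, hs, hu, m, by rw [Nat.add_sub_cancel, h]; simp⟩

theorem OmegaPlus_subset_iff {R Q : Tableau n} : OmegaPlus R ⊆ OmegaPlus Q ↔
    ∀ k s u, 1 ≤ k → k < n → s ∈ Icc 1 (k + 1) → u ∈ Icc 1 k → ∀ m : ℤ, 0 ≤ m →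
      entry R (k + 1) s = entry R k u + m → ∃ m' : ℤ, 0 ≤ m' ∧
        entry Q (k + 1) s = entry Q k u + m' := by
  constructor
  · intro h k s u hk hkn hs hu m hm he
    exact (mem_OmegaPlus_iff hk hkn hs hu).1 (h ((mem_OmegaPlus_iff hk hkn hs hu).2 ⟨m, hm, he⟩))
  · rintro h ⟨p, s, u⟩ hp
    obtain ⟨k, rfl⟩ : ∃ k, p = k + 1 := ⟨p - 1, by have := hp.1; omega⟩
    have hk : 1 ≤ k := Nat.lt_succ_iff.1 hp.1
    have hkn : k < n := hp.2.1
    obtain ⟨m, hm, he⟩ := (mem_OmegaPlus_iff hk hkn hp.2.2.1 hp.2.2.2.1).1 hp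
    exact (mem_OmegaPlus_iff hk hkn hp.2.2.1 hp.2.2.2.1).2
      (h k s u hk hkn hp.2.2.1 hp.2.2.2.1 m hm he)

/-- If `Ω⁺(R) ⊆ Ω⁺(Q)` and some entry of `R` is smaller than that of `Q`, then such an entry can
be raised. -/
theorem exists_raise (hL : IsGeneric L) {R Q : tableaux L} (h : OmegaPlus R.1 ⊆ OmegaPlus Q.1)
    (hex : ∃ k i, k < n ∧ i ∈ Icc 1 k ∧ 0 < gap R Q k i) :
    ∃ k i, k < n ∧ i ∈ Icc 1 k ∧ 0 < gap R Q k i ∧ upCoeff R.1 k i ≠ 0 ∧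
      OmegaPlus (shift R k i 1).1 ⊆ OmegaPlus Q.1 := by
  rw [OmegaPlus_subset_iff] at h
  let U := (range n ×ˢ range n).filter fun p => p.2 ∈ Icc 1 p.1 ∧ 0 < gap R Q p.1 p.2
  have hU : ∀ k i, k < n → i ∈ Icc 1 k → 0 < gap R Q k i → (k, i) ∈ U := fun k i hk hi hg => by
    have := mem_Icc.1 hi
    simp only [U, mem_filter, mem_product, Finset.mem_range]
    exact ⟨⟨hk, by omega⟩, hi, hg⟩
  obtain ⟨k₀, i₀, hk₀, hi₀, hg₀⟩ := hex
  -- Among the entries that must go up, choose one of largest real part and, among those, in the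
  -- highest row number. No such entry then lies ahead of it to block the move.
  obtain ⟨⟨k, i⟩, hmem, hmax⟩ := U.exists_max_image
    (fun p => toLex ((entry R.1 p.1 p.2).re, p.1)) ⟨_, hU k₀ i₀ hk₀ hi₀ hg₀⟩
  simp only [U, mem_filter, mem_product, Finset.mem_range] at hmem
  obtain ⟨⟨hk, -⟩, hi, hg⟩ := hmem
  have hk1 : 1 ≤ k := by simp only [mem_Icc] at hi; omega
  have hmax : ∀ l j, l < n → j ∈ Icc 1 l → 0 < gap R Q l j →
      (entry R.1 l j).re < (entry R.1 k i).re ∨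
        (entry R.1 l j).re = (entry R.1 k i).re ∧ l ≤ k := fun l j hl hj hp =>
    Prod.Lex.toLex_le_toLex.1 (hmax (l, j) (hU l j hl hj hp))
  refine ⟨k, i, hk, hi, hg, ?_, ?_⟩
  · rw [Ne, hL.upCoeff_eq_zero_iff R hk hi]
    -- A blocking entry `r_{k+1,j} = r_{ki}` gives a triple in `Ω⁺(R) ⊆ Ω⁺(Q)`, so it has to rise at
    -- least as much as `r_{ki}`. It is therefore not in the top row, and its larger row number
    -- contradicts the choice of `(k, i)`.
    rintro ⟨j, hj, hij⟩
    obtain ⟨m, hm, he⟩ := h k j i hk1 hk hj hi 0 le_rfl (by rw [hij]; simp)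
    have hgj : gap R Q (k + 1) j = m + gap R Q k i := gap_eq_of_entry_eq (by
      rw [he, entry_eq_add_gap R Q, hij]; push_cast; ring)
    have hlt : k + 1 < n := lt_of_le_of_ne hk (by
      rintro rfl
      rw [gap_top] at hgj
      omega)
    rcases hmax (k + 1) j hlt hj (by omega) with h1 | h1
    · rw [hij] at h1; exact lt_irrefl _ h1
    · omega
  · rw [OmegaPlus_subset_iff]
    intro l s u hl hln hs hu m hm he
    rw [entry_shift R 1 hk hi, entry_shift R 1 hk hi] at he
    by_cases h1 : l = k ∧ u = i
    · obtain ⟨rfl, rfl⟩ := h1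
      rw [if_neg (by omega), if_pos ⟨rfl, rfl⟩] at he
      exact h l s u hl hln hs hu (m + 1) (by omega) (by push_cast at he ⊢; linear_combination he)
    by_cases h2 : l + 1 = k ∧ s = i
    · obtain ⟨rfl, rfl⟩ := h2
      rw [if_pos ⟨rfl, rfl⟩, if_neg h1] at he
      obtain rfl | hm0 := hm.eq_or_lt
      -- The only way to gain a triple: the difference from the entry in the row below passes from
      -- `-1` to `0`. That entry is larger by `1`, so by maximality it need not rise, while `r_{ki}`
      -- rises by at least `1`; hence the triple belongs to `Ω⁺(Q)`.
      · refine ⟨gap R Q (l + 1) s - 1 - gap R Q l u, ?_, ?_⟩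
        · by_contra hneg
          have hre := congrArg Complex.re he
          simp only [Complex.add_re, Int.cast_one, Complex.one_re, Int.cast_zero,
            Complex.zero_re] at hre
          rcases hmax l u hln hu (by omega) with h3 | h3 <;> linarith [h3]
        · rw [entry_eq_add_gap R Q, entry_eq_add_gap R Q l]
          push_cast at he ⊢
          linear_combination he
      · exact h l s u hl hln hs hu (m - 1) (by omega)
          (by push_cast at he ⊢; linear_combination he)
    · rw [if_neg h1, if_neg h2, add_zero, add_zero] at he
      exact h l s u hl hln hs hu m hm he

/-- If `Ω⁺(R) ⊆ Ω⁺(Q)` and some entry of `R` is larger than that of `Q`, then such an entry can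
be lowered. -/
theorem exists_lower (hL : IsGeneric L) {R Q : tableaux L} (h : OmegaPlus R.1 ⊆ OmegaPlus Q.1)
    (hex : ∃ k i, k < n ∧ i ∈ Icc 1 k ∧ gap R Q k i < 0) :
    ∃ k i, k < n ∧ i ∈ Icc 1 k ∧ gap R Q k i < 0 ∧ downCoeff R.1 k i ≠ 0 ∧
      OmegaPlus (shift R k i (-1)).1 ⊆ OmegaPlus Q.1 := by
  rw [OmegaPlus_subset_iff] at h
  let U := (range n ×ˢ range n).filter fun p => p.2 ∈ Icc 1 p.1 ∧ gap R Q p.1 p.2 < 0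
  have hU : ∀ k i, k < n → i ∈ Icc 1 k → gap R Q k i < 0 → (k, i) ∈ U := fun k i hk hi hg => by
    have := mem_Icc.1 hi
    simp only [U, mem_filter, mem_product, Finset.mem_range]
    exact ⟨⟨hk, by omega⟩, hi, hg⟩
  obtain ⟨k₀, i₀, hk₀, hi₀, hg₀⟩ := hex
  -- Dual choice: smallest real part, then smallest row number, since lowering is blocked by an
  -- equal entry of row `k - 1`.
  obtain ⟨⟨k, i⟩, hmem, hmin⟩ := U.exists_min_image
    (fun p => toLex ((entry R.1 p.1 p.2).re, p.1)) ⟨_, hU k₀ i₀ hk₀ hi₀ hg₀⟩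
  simp only [U, mem_filter, mem_product, Finset.mem_range] at hmem
  obtain ⟨⟨hk, -⟩, hi, hg⟩ := hmem
  have hmin : ∀ l j, l < n → j ∈ Icc 1 l → gap R Q l j < 0 →
      (entry R.1 k i).re < (entry R.1 l j).re ∨
        (entry R.1 k i).re = (entry R.1 l j).re ∧ k ≤ l := fun l j hl hj hp =>
    Prod.Lex.toLex_le_toLex.1 (hmin (l, j) (hU l j hl hj hp))
  refine ⟨k, i, hk, hi, hg, ?_, ?_⟩
  · rw [Ne, hL.downCoeff_eq_zero_iff R hk hi]
    rintro ⟨j, hj, hij⟩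
    obtain ⟨l, rfl⟩ : ∃ l, k = l + 1 := ⟨k - 1, by simp only [mem_Icc] at hi; omega⟩
    rw [Nat.add_sub_cancel] at hj hij
    obtain ⟨m, hm, he⟩ := h l i j (by simp only [mem_Icc] at hj; omega) (by omega) hi hj 0 le_rfl
      (by rw [hij]; simp)
    have hgj : gap R Q l j = gap R Q (l + 1) i - m := gap_eq_of_entry_eq (by
      rw [entry_eq_add_gap R Q, hij] at he
      push_cast
      linear_combination -he)
    rcases hmin l j (by omega) hj (by omega) with h1 | h1
    · rw [hij] at h1; exact lt_irrefl _ h1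
    · omega
  · rw [OmegaPlus_subset_iff]
    intro l s u hl hln hs hu m hm he
    rw [entry_shift R (-1) hk hi, entry_shift R (-1) hk hi] at he
    by_cases h1 : l + 1 = k ∧ s = i
    · obtain ⟨rfl, rfl⟩ := h1
      rw [if_pos ⟨rfl, rfl⟩, if_neg (by omega)] at he
      exact h l s u hl hln hs hu (m + 1) (by omega) (by push_cast at he ⊢; linear_combination he)
    by_cases h2 : l = k ∧ u = i
    · obtain ⟨rfl, rfl⟩ := h2
      rw [if_neg h1, if_pos ⟨rfl, rfl⟩] at he
      obtain rfl | hm0 := hm.eq_or_lt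
      · refine ⟨gap R Q (l + 1) s - 1 - gap R Q l u, ?_, ?_⟩
        · by_contra hneg
          -- Here the gained triple may involve the top row, to which minimality does not apply.
          -- There the gap is `0`, and `-1 - gap R Q l u` is nonnegative anyway.
          have hlt : l + 1 < n := lt_of_le_of_ne hln (by
            rintro rfl
            rw [gap_top] at hneg
            omega)
          have hre := congrArg Complex.re he
          simp only [Complex.add_re, Int.cast_one, Complex.one_re, Int.cast_zero, Int.cast_neg,
            Complex.neg_re, Complex.zero_re] at hre
          rcases hmin (l + 1) s hlt hs (by omega) with h3 | h3 <;> linarith [h3]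
        · rw [entry_eq_add_gap R Q, entry_eq_add_gap R Q l]
          push_cast at he ⊢
          linear_combination he
      · exact h l s u hl hln hs hu (m - 1) (by omega)
          (by push_cast at he ⊢; linear_combination he)
    · rw [if_neg h1, if_neg h2, add_zero, add_zero] at he
      exact h l s u hl hln hs hu m hm he

/-- The total distance to `Q` below the top row is the measure for the induction along a path. -/
theorem sum_gap_shift_lt {R Q : tableaux L} {k i : ℕ} {e : ℤ} (hk : k < n) (hi : i ∈ Icc 1 k)
    (he : (gap R Q k i - e).natAbs < (gap R Q k i).natAbs) :
    ∑ p ∈ range n ×ˢ range n, (gap (shift R k i e) Q p.1 p.2).natAbs <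
      ∑ p ∈ range n ×ˢ range n, (gap R Q p.1 p.2).natAbs := by
  have hmem : (k, i) ∈ range n ×ˢ range n := by
    simp only [mem_Icc, mem_product, Finset.mem_range] at hi ⊢; omega
  refine Finset.sum_lt_sum (fun p _ => ?_) ⟨(k, i), hmem, ?_⟩
  · rw [gap_shift R Q e hk hi]
    split_ifs with hp
    · rw [hp.1, hp.2]; exact he.le
    · rw [sub_zero]
  · rw [gap_shift R Q e hk hi, if_pos ⟨rfl, rfl⟩]; exact he

/-- A stable subspace containing `R` contains every `Q` with `Ω⁺(R) ⊆ Ω⁺(Q)`. -/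
theorem IsGTStable.vec_mem_of_OmegaPlus_subset {W : Submodule ℂ (FormalSpan (tableaux L))}
    (hL : IsGeneric L) (hW : IsGTStable W) {R Q : tableaux L} (hR : vec R 1 ∈ W)
    (h : OmegaPlus R.1 ⊆ OmegaPlus Q.1) : vec Q 1 ∈ W := by
  induction hd : ∑ p ∈ range n ×ˢ range n, (gap R Q p.1 p.2).natAbs using
    Nat.strong_induction_on generalizing R with
  | _ d ih =>
    subst hd
    by_cases hup : ∃ k i, k < n ∧ i ∈ Icc 1 k ∧ 0 < gap R Q k i
    · obtain ⟨k, i, hk, hi, hg, hc, hs⟩ := exists_raise hL h hup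
      exact ih _ (sum_gap_shift_lt hk hi (by omega)) (hW.vec_shift_up_mem hL hk hi hR hc) hs rfl
    by_cases hdn : ∃ k i, k < n ∧ i ∈ Icc 1 k ∧ gap R Q k i < 0
    · obtain ⟨k, i, hk, hi, hg, hc, hs⟩ := exists_lower hL h hdn
      exact ih _ (sum_gap_shift_lt hk hi (by omega)) (hW.vec_shift_down_mem hL hk hi hR hc) hs rfl
    push Not at hup hdn
    have : R = Q := tableaux_ext fun k hk i hi => by
      rw [entry_eq_add_gap R Q, le_antisymm (hup k i hk hi) (hdn k i hk hi)]; simp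
    exact this ▸ hR

/-! ### Finiteness of the values of `Ω⁺`, minimal tableaux and generation -/

theorem finite_range_OmegaPlus : (Set.range (OmegaPlus (n := n))).Finite := by
  have hfin : {x : ℕ × ℕ × ℕ | x.1 ≤ n ∧ x.2.1 ≤ n ∧ x.2.2 ≤ n}.Finite :=
    ((Set.finite_Iic n).prod ((Set.finite_Iic n).prod (Set.finite_Iic n))).subset
      fun x hx => ⟨hx.1, hx.2.1, hx.2.2⟩
  refine hfin.finite_subsets.subset ?_
  rintro _ ⟨R, rfl⟩ ⟨p, s, u⟩ ⟨h1, h2, h3, h4, -⟩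
  simp only [mem_Icc] at h3 h4
  exact ⟨h2, show s ≤ n by omega, show u ≤ n by omega⟩

section
variable {hL : IsGeneric L} {N : LieSubmodule ℂ (gl n) (GTModule L hL)}

theorem exists_minimalTableaux_le {P : tableaux L} (hP : tab hL P ∈ N) :
    ∃ R ∈ minimalTableaux N, OmegaPlus R.1 ⊆ OmegaPlus P.1 := by
  have hfin : ((fun R : tableaux L => OmegaPlus R.1) ''
      {R | tab hL R ∈ N ∧ OmegaPlus R.1 ⊆ OmegaPlus P.1}).Finite :=
    finite_range_OmegaPlus.subset (by rintro _ ⟨R, -, rfl⟩; exact ⟨R.1, rfl⟩)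
  obtain ⟨_, ⟨⟨R, ⟨hRN, hRP⟩, rfl⟩, hmin⟩⟩ :=
    hfin.exists_minimal ⟨_, P, ⟨hP, subset_rfl⟩, rfl⟩
  -- Minimality below `Ω⁺(P)` is minimality in `N`: any competitor below `R` is also below `P`.
  exact ⟨R, ⟨hRN, fun Q hQ hQR => hQR.antisymm (hmin ⟨Q, ⟨hQ, hQR.trans hRP⟩, rfl⟩ hQR)⟩, hRP⟩

/-- Uniqueness of representatives makes `Ω⁺` injective on `S`, and `Ω⁺` takes finitely many values.
-/
theorem IsSetOfRepresentatives.finite {Φ S : Set (tableaux L)} (hS : IsSetOfRepresentatives Φ S) :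
    S.Finite := by
  refine Set.Finite.of_finite_image (f := fun R : tableaux L => OmegaPlus R.1)
    (finite_range_OmegaPlus.subset (by rintro _ ⟨R, -, rfl⟩; exact ⟨R.1, rfl⟩)) ?_
  intro R hR Q hQ h
  exact (hS.2 Q (hS.1 hQ)).unique ⟨hR, h⟩ ⟨hQ, rfl⟩

theorem exists_isSetOfRepresentatives (Φ : Set (tableaux L)) :
    ∃ S, IsSetOfRepresentatives Φ S := by
  obtain ⟨S, hS, hbij⟩ := Set.SurjOn.exists_bijOn_subset
    (Set.surjOn_image (fun R : tableaux L => OmegaPlus R.1) Φ)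
  refine ⟨S, hS, fun R hR => ?_⟩
  obtain ⟨Q, hQ, h⟩ := hbij.surjOn ⟨R, hR, rfl⟩
  exact ⟨Q, ⟨hQ, h⟩, fun Q' hQ' => hbij.injOn hQ'.1 hQ (hQ'.2.trans h.symm)⟩

/-- It suffices to compare tableaux. One in `N` lies above a minimal one, hence above its
representative, and is therefore in the submodule which that representative generates. -/
theorem IsSetOfRepresentatives.eq_iSup (hn : 0 < n) {S : Set (tableaux L)}
    (hS : IsSetOfRepresentatives (minimalTableaux N) S) : N = ⨆ R ∈ S, cyclicSubmodule hL R := by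
  apply le_antisymm
  · refine IsGTStable.le_of_vec_mem hn hL (isGTStable_toSubmodule N)
      (W' := ((⨆ R ∈ S, cyclicSubmodule hL R : LieSubmodule ℂ (gl n) (GTModule L hL)) :
        Submodule ℂ (GTModule L hL))) fun P hP => ?_
    obtain ⟨R, hR, hRP⟩ := exists_minimalTableaux_le (hL := hL) (N := N) (P := P) hP
    obtain ⟨Q, ⟨hQS, hQR⟩, -⟩ := hS.2 R hR
    have hQ : tab hL Q ∈ cyclicSubmodule hL Q :=
      LieSubmodule.subset_lieSpan (Set.mem_singleton _)
    have hPQ : tab hL P ∈ cyclicSubmodule hL Q :=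
      (isGTStable_toSubmodule (cyclicSubmodule hL Q)).vec_mem_of_OmegaPlus_subset hL
        hQ (hQR.trans_subset hRP)
    have hle : cyclicSubmodule hL Q ≤ ⨆ R ∈ S, cyclicSubmodule hL R :=
      le_iSup₂_of_le (f := fun R (_ : R ∈ S) => cyclicSubmodule hL R) Q hQS le_rfl
    exact hle hPQ
  · refine iSup₂_le fun R hR => ?_
    rw [cyclicSubmodule, LieSubmodule.lieSpan_le, Set.singleton_subset_iff]
    exact (hS.1 hR).1

end
end
end GT

theorem mainTheorem7 (n : ℕ) (hn : 2 ≤ n) (L : GT.Tableau n) (hL : GT.IsGeneric L)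
    (N : LieSubmodule ℂ (GT.gl n) (GT.GTModule L hL)) :
    (∃ s : Finset (GT.GTModule L hL),
      N = LieSubmodule.lieSpan ℂ (GT.gl n) (s : Set (GT.GTModule L hL))) ∧
    (∃ S : Set (GT.tableaux L), GT.IsSetOfRepresentatives (GT.minimalTableaux N) S) ∧
    (∀ S : Set (GT.tableaux L), GT.IsSetOfRepresentatives (GT.minimalTableaux N) S →
      S.Finite ∧ N = ⨆ R ∈ S, GT.cyclicSubmodule hL R) := by
  have hn0 : 0 < n := by omega
  obtain ⟨S, hS⟩ := GT.exists_isSetOfRepresentatives (GT.minimalTableaux N)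
  refine ⟨⟨(hS.finite.image (GT.tab hL)).toFinset, ?_⟩, ⟨S, hS⟩,
    fun S hS => ⟨hS.finite, hS.eq_iSup hn0⟩⟩
  -- The generators are the tableaux of `S`; writing them as a union of singletons turns their span
  -- into the supremum of the cyclic submodules.
  rw [Set.Finite.coe_toFinset, ← Set.biUnion_of_singleton (GT.tab hL '' S), Set.biUnion_image]
  simp only [LieSubmodule.span_iUnion]
  exact hS.eq_iSup hn0
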